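/- Let $\nu$ be a nonatomic, $\sigma$-finite measure on $[0,1]$ with $\nu([0,1])=\infty$ and $\int_0^1 w\,\nu(dw)<\infty$. Let $(w_i)_{i\in\mathbb N}$ enumerate a Poisson point process on $[0,1]$ with rate measure $\nu$. Given $(w_i)_i$, let $\Pi_{ij}$, $i\le j$, be independent Poisson processes on $[0,\infty)$, with constant rate $w_iw_j$ if $i<j$ and rate $0$ if $i=j$, and put $\Pi_{ji}=\Pi_{ij}$ and $\Pi_i=\bigcup_j\Pi_{ij}$. For $t\ge 0$ let $$D'_{t,i}=|\Pi_i\cap[0,t]|,\qquad \bar D'_{t,i}=\sum_j \mathbf 1\big(|\Pi_{ij}\cap[0,t]|>0\big),$$ $$|V'_t|=\sum_i\mathbf 1(D'_{t,i}>0),\qquad |E'_t|=\tfrac12\sum_i D'_{t,i},\qquad |\bar E'_t|=\tfrac12\sum_i\bar D'_{t,i}$$ be the Poissonized numbers of vertices, of edges of the multigraph, and of edges of the binary graph. Suppose that the tail of $\nu$ is regularly varying, that is, $\alpha\in(0,1)$ and $\ell:\mathbb R_+\to\mathbb R_+$ satisfy $$\nu([x,1])\sim x^{-\alpha}\ell(x^{-1})\quad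 (x\to0^+),\qquad \lim_{x\to\infty}\frac{\ell(cx)}{\ell(x)}=1\ \text{ for all } c>0.$$ Then the expectations $\mathbb E|V'_n|$, $\mathbb E|E'_n|$, $\mathbb E|\bar E'_n|$ are finite for every natural number $n$, and, as $n\to\infty$, $$\mathbb E|V'_n|=\Theta(n^\alpha\ell(n)),\qquad \mathbb E|E'_n|=\Theta(n),\qquad \mathbb E|\bar E'_n|=O\Big(\ell(\sqrt n)\min\big(n^{\frac{1+\alpha}2},\,\ell(n)\,n^{\frac{3\alpha}2}\big)\Big).$$ -/

import Mathlib

open MeasureTheory ProbabilityTheory Filter Asymptotics Topology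
open scoped ENNReal NNReal

noncomputable section

/-- The random sequence `x 0, x 1, …` of points of `S` is an enumeration of a Poisson point process
with rate measure `ν`: the number of points in a measurable set `A` with `ν A < ∞` is Poisson
distributed with parameter `ν A`, and the numbers of points in finitely many pairwise disjoint
measurable sets are independent. -/
structure IsPoissonPointProcess {S Ω : Type*} [MeasurableSpace S] [MeasurableSpace Ω]
    (ν : Measure S) (P : Measure Ω) (x : ℕ → Ω → S) : Prop where
  measurable : ∀ i, Measurable (x i)
  poisson : ∀ A : Set S, MeasurableSet A → ν A ≠ ∞ →
    HasLaw (fun ω => {i | x i ω ∈ A}.encard)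
      ((poissonMeasure (ν A).toNNReal).map (Nat.cast : ℕ → ℕ∞)) P
  indep : ∀ (m : ℕ) (A : Fin m → Set S), (∀ a, MeasurableSet (A a)) →
    (∀ a b, a ≠ b → Disjoint (A a) (A b)) →
    iIndepFun (fun (a : Fin m) (ω : Ω) => {i | x i ω ∈ A a}.encard) P

/-- The rate of the process of edges between the vertices `i` and `j`, when the weights of the
vertices are `u 0, u 1, …` (there are no self-loops). -/
def edgeRate (u : ℕ → unitInterval) (i j : ℕ) : ℝ≥0 :=
  if i = j then 0 else unitInterval.toNNReal (u i) * unitInterval.toNNReal (u j)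

/-- The σ-algebra generated by the sequence of weights. -/
abbrev weightSigma {Ω : Type*} (w : ℕ → Ω → unitInterval) : MeasurableSpace Ω :=
  MeasurableSpace.comap (fun ω i => w i ω) MeasurableSpace.pi

/-- The Poissonized random graph. The vertices are the natural numbers; the vertex weights `w i`
form a Poisson point process on `[0, 1]` with rate measure `ν`. The random set
`T i j ω ⊆ [0, ∞)` is the set of times at which an edge is added between `i` and `j`. Conditionally
on the weights, the `T i j` with `i ≤ j` are independent Poisson processes on `[0, ∞)`, the process
`T i j` having the constant rate `edgeRate`, and `T j i = T i j`.

The field `conditional_law` gives the conditional joint distribution of the numbers of points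
of these processes in finitely many Borel sets of finite length, the sets that belong to the same
process being disjoint: they are independent, and Poisson with parameter rate times length. -/
structure IsPoissonizedGraph {Ω : Type*} [MeasurableSpace Ω] (ν : Measure unitInterval)
    (P : Measure Ω) (w : ℕ → Ω → unitInterval) (T : ℕ → ℕ → Ω → Set ℝ) : Prop where
  weights : IsPoissonPointProcess ν P w
  nonneg : ∀ i j ω, T i j ω ⊆ Set.Ici 0
  symm : ∀ i j ω, T j i ω = T i j ω
  measurable : ∀ i j (B : Set ℝ), MeasurableSet B → Measurable fun ω => (T i j ω ∩ B).encard
  conditional_law : ∀ (m : ℕ) (e : Fin m → ℕ × ℕ) (B : Fin m → Set ℝ) (k : Fin m → ℕ),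
    (∀ a, (e a).1 ≤ (e a).2) →
    (∀ a, MeasurableSet (B a) ∧ B a ⊆ Set.Ici 0 ∧ volume (B a) ≠ ∞) →
    (∀ a b, a ≠ b → e a = e b → Disjoint (B a) (B b)) →
    P⟦{ω | ∀ a, (T (e a).1 (e a).2 ω ∩ B a).encard = k a} | weightSigma w⟧ =ᵐ[P] fun ω =>
      ∏ a, (poissonMeasure
        (edgeRate (fun i => w i ω) (e a).1 (e a).2 * (volume (B a)).toNNReal)).real {k a}

section counts

variable {Ω : Type*} (T : ℕ → ℕ → Ω → Set ℝ) (t : ℝ) (ω : Ω)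

/-- The degree of the vertex `i` in the multigraph at time `t`, i.e. the number of points in
`[0, t]` of the union of the `T i j` over all `j`. -/
def vertexDegree (i : ℕ) : ℕ∞ := ((⋃ j, T i j ω) ∩ Set.Icc 0 t).encard

/-- The degree of the vertex `i` in the binary graph at time `t`, i.e. the number of vertices `j`
to which `i` is joined by at least one edge. -/
def binaryDegree (i : ℕ) : ℕ∞ := {j | 0 < (T i j ω ∩ Set.Icc 0 t).encard}.encard

/-- The number of active vertices (those of positive degree) at time `t`. -/
def numVertices : ℝ≥0∞ := ({i | 0 < vertexDegree T t ω i}.encard : ℕ∞)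

/-- The number of edges of the multigraph at time `t`. -/
def numEdges : ℝ≥0∞ := 2⁻¹ * ∑' i, (vertexDegree T t ω i : ℝ≥0∞)

/-- The number of edges of the binary graph at time `t`. -/
def numBinaryEdges : ℝ≥0∞ := 2⁻¹ * ∑' i, (binaryDegree T t ω i : ℝ≥0∞)

end counts

/-- The function `ℓ : (0, ∞) → [0, ∞)` is slowly varying at infinity. Values of `ℓ` outside
`(0, ∞)` play no role. -/
def IsSlowlyVarying (l : ℝ → ℝ) : Prop :=
  (∀ x, 0 < x → 0 ≤ l x) ∧ ∀ c, 0 < c → Tendsto (fun x => l (c * x) / l x) atTop (𝓝 1)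

/-- The tail of `ν` is regularly varying with exponent `α ∈ (0, 1)` and slowly varying function
`ℓ`: `ν [x, 1] ∼ x ^ (-α) ℓ(1 / x)` as `x → 0`, `x > 0`. -/
def HasRegularlyVaryingTail (ν : Measure unitInterval) (α : ℝ) (l : ℝ → ℝ) : Prop :=
  0 < α ∧ α < 1 ∧ IsSlowlyVarying l ∧
    (fun x : ℝ => ν.real {v : unitInterval | x ≤ (v : ℝ)}) ~[𝓝[>] 0]
      fun x : ℝ => x ^ (-α) * l x⁻¹

end

/-!
By Stein's identity `E[N f(N)] = r E[f(N + 1)]` for a Poisson variable `N` of parameter `r`, the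
weights obey Campbell's formula, and their second factorial moment measure is `ν ⊗ ν`. Expectations
of sums over vertices or pairs of vertices are therefore integrals against `ν` or `ν ⊗ ν`; for
instance, the expected number of edges is of the order of `t (∫ v dν)²`.

For the upper bounds, a heavy vertex is merely counted, and a light one is charged its expected
degree: the vertices are split at the weight `1 / t`, those of the binary graph at `1 / √t`. Since
`α < 1`, Karamata's theorem bounds the truncated first moment of `ν` below `x` by a multiple of
`x ν [x, 1]`, so that heavy and light vertices contribute the same order. For the lower bound on the
number of vertices, fix `a` with `ν [a, 1] > 0`: with a probability bounded away from `0`, a vertex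
of weight at least `1 / t` is joined by time `t` to one of weight at least `a`.
-/

/-! ### Moments of a Poisson point process -/

lemma generateFrom_setOf_measurableSet_and_measure_ne_top {S : Type*} [MeasurableSpace S]
    (ν : Measure S) [SigmaFinite ν] :
    MeasurableSpace.generateFrom {A | MeasurableSet A ∧ ν A ≠ ∞} = ‹MeasurableSpace S› := by
  refine le_antisymm (MeasurableSpace.generateFrom_le fun A hA => hA.1) fun A hA => ?_
  rw [← Set.inter_univ A, ← iUnion_spanningSets ν, Set.inter_iUnion]
  refine @MeasurableSet.iUnion _ _ (_) _ _ fun i => MeasurableSpace.measurableSet_generateFrom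
    ⟨hA.inter (measurableSet_spanningSets ν i), ?_⟩
  exact measure_ne_top_of_subset Set.inter_subset_right (measure_spanningSets_lt_top ν i).ne

lemma isPiSystem_setOf_measurableSet_and_measure_ne_top {S : Type*} [MeasurableSpace S]
    (ν : Measure S) : IsPiSystem {A | MeasurableSet A ∧ ν A ≠ ∞} := fun _ hA _ hB _ =>
  ⟨hA.1.inter hB.1, measure_ne_top_of_subset Set.inter_subset_left hA.2⟩

/-- The measurable sets of finite measure span a σ-finite measure space. They form the π-system on
which the moment measures of a point process are identified. -/
noncomputable def finiteMeasureSpanningSets {S : Type*} [MeasurableSpace S] (ν : Measure S)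
    [SigmaFinite ν] : ν.FiniteSpanningSetsIn {A | MeasurableSet A ∧ ν A ≠ ∞} where
  set := spanningSets ν
  set_mem n := ⟨measurableSet_spanningSets ν n, (measure_spanningSets_lt_top ν n).ne⟩
  finite := measure_spanningSets_lt_top ν
  spanning := iUnion_spanningSets ν

section PoissonMoments

lemma lintegral_mul_poissonMeasure (r : ℝ≥0) (f : ℕ → ℝ≥0∞) :
    ∫⁻ k, (k : ℝ≥0∞) * f k ∂(poissonMeasure r) = r * ∫⁻ k, f (k + 1) ∂(poissonMeasure r) := by
  have hweight (k : ℕ) : ((k + 1 : ℕ) : ℝ≥0∞) *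
      ENNReal.ofReal (Real.exp (-r) * r ^ (k + 1) / (k + 1).factorial) =
      r * ENNReal.ofReal (Real.exp (-r) * r ^ k / k.factorial) := by
    rw [← ENNReal.ofReal_natCast, ← ENNReal.ofReal_coe_nnreal, ← ENNReal.ofReal_mul (by positivity),
      ← ENNReal.ofReal_mul (by positivity), Nat.factorial_succ]
    congr 1
    push_cast
    field_simp
    ring
  rw [lintegral_countable', lintegral_countable', tsum_eq_zero_add' ENNReal.summable,
    ← ENNReal.tsum_mul_left]
  simp only [CharP.cast_eq_zero, zero_mul, zero_add, poissonMeasure_singleton]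
  exact tsum_congr fun k => by rw [mul_right_comm, hweight, mul_right_comm, mul_assoc]

lemma lintegral_natCast_poissonMeasure (r : ℝ≥0) :
    ∫⁻ k, (k : ℝ≥0∞) ∂(poissonMeasure r) = r := by
  simpa using lintegral_mul_poissonMeasure r 1

lemma poissonMeasure_compl_zero (r : ℝ≥0) :
    poissonMeasure r {0}ᶜ = ENNReal.ofReal (1 - Real.exp (-r)) := by
  rw [prob_compl_eq_one_sub (measurableSet_singleton 0), poissonMeasure_singleton,
    ENNReal.ofReal_sub _ (Real.exp_nonneg _)]
  simp

end PoissonMoments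

/-- The number of terms of the random sequence `x` in the set `A`. -/
noncomputable def pointCount {S Ω : Type*} (x : ℕ → Ω → S) (A : Set S) (ω : Ω) : ℝ≥0∞ :=
  ({i | x i ω ∈ A}.encard : ℕ∞)

section PointCount

variable {S Ω : Type*} {x : ℕ → Ω → S} {A B : Set S} {ω : Ω}

lemma pointCount_eq_tsum (x : ℕ → Ω → S) (A : Set S) (ω : Ω) :
    pointCount x A ω = ∑' i, A.indicator (fun _ => (1 : ℝ≥0∞)) (x i ω) := by
  rw [pointCount, ← ENNReal.tsum_set_one, tsum_subtype {i | x i ω ∈ A} fun _ => (1 : ℝ≥0∞)]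
  rfl

lemma pointCount_inter_add_diff (x : ℕ → Ω → S) (A B : Set S) (ω : Ω) :
    pointCount x (A ∩ B) ω + pointCount x (A \ B) ω = pointCount x A ω := by
  rw [pointCount, pointCount, ← ENat.toENNReal_add, ← Set.encard_union_eq]
  · rw [← Set.ofPred_or]
    simp only [pointCount, Set.mem_inter_iff, Set.mem_sdiff, ← and_or_left, em, and_true]
  · exact Set.disjoint_left.2 fun i hi hi' => hi'.2 hi.2

lemma pointCount_add_diff_of_subset (x : ℕ → Ω → S) (hAB : A ⊆ B) (ω : Ω) :
    pointCount x A ω + pointCount x (B \ A) ω = pointCount x B ω := by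
  rw [← pointCount_inter_add_diff x B A, Set.inter_eq_right.2 hAB]

lemma pointCount_mul_pointCount (x : ℕ → Ω → S) (A B : Set S) (ω : Ω) :
    pointCount x A ω * pointCount x B ω =
      pointCount x (A ∩ B) ω + ∑' i, ∑' j, if i = j then 0 else
        (A ×ˢ B).indicator (fun _ => (1 : ℝ≥0∞)) (x i ω, x j ω) := by
  have hprod (i j : ℕ) : A.indicator (fun _ => (1 : ℝ≥0∞)) (x i ω) *
      B.indicator (fun _ => 1) (x j ω) = (A ×ˢ B).indicator (fun _ => 1) (x i ω, x j ω) := by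
    by_cases hi : x i ω ∈ A <;> by_cases hj : x j ω ∈ B <;> simp [hi, hj]
  rw [pointCount_eq_tsum x A, pointCount_eq_tsum x (A ∩ B), ← ENNReal.tsum_mul_right,
    ← ENNReal.tsum_add]
  refine tsum_congr fun i => ?_
  rw [pointCount_eq_tsum, ← ENNReal.tsum_mul_left, tsum_congr (hprod i),
    ENNReal.tsum_eq_add_tsum_ite i]
  simp only [eq_comm (a := i)]
  congr!

end PointCount

namespace IsPoissonPointProcess

variable {S Ω : Type*} [MeasurableSpace S] [MeasurableSpace Ω] {ν : Measure S} {P : Measure Ω}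
  {x : ℕ → Ω → S} {A B : Set S} (h : IsPoissonPointProcess ν P x)
include h

lemma isProbabilityMeasure : IsProbabilityMeasure P :=
  have := Measure.isProbabilityMeasure_map (μ := poissonMeasure (ν ∅).toNNReal)
    (f := (Nat.cast : ℕ → ℕ∞)) (by fun_prop)
  (h.poisson ∅ .empty (by simp)).isProbabilityMeasure

lemma measurable_pointCount (hA : MeasurableSet A) : Measurable (pointCount x A) := by
  simp_rw [funext (pointCount_eq_tsum x A)]
  exact .tsum fun i => (measurable_const.indicator hA).comp (h.measurable i)

lemma lintegral_comp_pointCount (hA : MeasurableSet A) (hA' : ν A ≠ ∞) {f : ℝ≥0∞ → ℝ≥0∞}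
    (hf : Measurable f) :
    ∫⁻ ω, f (pointCount x A ω) ∂P = ∫⁻ k, f k ∂(poissonMeasure (ν A).toNNReal) := by
  refine ((h.poisson A hA hA').lintegral_comp (f := fun k : ℕ∞ => f k) (by fun_prop)).trans ?_
  rw [lintegral_map (by fun_prop) (by fun_prop)]
  simp

lemma lintegral_pointCount (hA : MeasurableSet A) (hA' : ν A ≠ ∞) :
    ∫⁻ ω, pointCount x A ω ∂P = ν A := by
  rw [h.lintegral_comp_pointCount (f := fun y => y) hA hA' measurable_id,
    lintegral_natCast_poissonMeasure, ENNReal.coe_toNNReal hA']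

lemma lintegral_comp_pointCount_mul_self (hA : MeasurableSet A) (hA' : ν A ≠ ∞)
    {f : ℝ≥0∞ → ℝ≥0∞} (hf : Measurable f) :
    ∫⁻ ω, f (pointCount x A ω) * pointCount x A ω ∂P =
      (∫⁻ ω, f (pointCount x A ω + 1) ∂P) * ν A := by
  rw [h.lintegral_comp_pointCount (f := fun y => f y * y) hA hA' (by fun_prop),
    h.lintegral_comp_pointCount (f := fun y => f (y + 1)) hA hA' (by fun_prop)]
  simpa [mul_comm, ENNReal.coe_toNNReal hA']
    using lintegral_mul_poissonMeasure (ν A).toNNReal fun k => f k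

lemma lintegral_comp_pointCount_mul_of_disjoint (hA : MeasurableSet A) (hB : MeasurableSet B)
    (hB' : ν B ≠ ∞) (hAB : Disjoint A B) {f : ℝ≥0∞ → ℝ≥0∞} (hf : Measurable f) :
    ∫⁻ ω, f (pointCount x A ω) * pointCount x B ω ∂P =
      (∫⁻ ω, f (pointCount x A ω) ∂P) * ν B := by
  have hindep : IndepFun (fun ω => {i | x i ω ∈ A}.encard) (fun ω => {i | x i ω ∈ B}.encard) P := by
    simpa using (h.indep 2 ![A, B] (by simp [Fin.forall_fin_two, hA, hB])
      (by simp [Fin.forall_fin_two, hAB, hAB.symm])).indepFun (i := 0) (j := 1) (by simp)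
  rw [← h.lintegral_pointCount hB hB']
  exact lintegral_mul_eq_lintegral_mul_lintegral_of_indepFun
    (hf.comp (h.measurable_pointCount hA)) (h.measurable_pointCount hB)
    (hindep.comp (φ := fun k : ℕ∞ => f k) (ψ := fun k : ℕ∞ => (k : ℝ≥0∞)) (by fun_prop)
      (by fun_prop))

lemma lintegral_comp_pointCount_mul_of_subset (hA : MeasurableSet A) (hB : MeasurableSet B)
    (hB' : ν B ≠ ∞) (hAB : A ⊆ B) {f : ℝ≥0∞ → ℝ≥0∞} (hf : Measurable f) :
    ∫⁻ ω, f (pointCount x A ω) * pointCount x B ω ∂P =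
      (∫⁻ ω, f (pointCount x A ω + 1) ∂P) * ν A +
        (∫⁻ ω, f (pointCount x A ω) ∂P) * ν (B \ A) := by
  have hcount := h.measurable_pointCount hA
  simp_rw [← pointCount_add_diff_of_subset x hAB, mul_add]
  rw [lintegral_add_left (by fun_prop),
    h.lintegral_comp_pointCount_mul_self hA (measure_ne_top_of_subset hAB hB') hf,
    h.lintegral_comp_pointCount_mul_of_disjoint hA (hB.diff hA)
      (measure_ne_top_of_subset Set.sdiff_subset hB') Set.disjoint_sdiff_right hf]

lemma lintegral_comp_pointCount_mul_le (hA : MeasurableSet A) (hB : MeasurableSet B)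
    (hB' : ν B ≠ ∞) (hAB : A ⊆ B) {f : ℝ≥0∞ → ℝ≥0∞} (hf : Monotone f) :
    (∫⁻ ω, f (pointCount x A ω) ∂P) * ν B ≤ ∫⁻ ω, f (pointCount x A ω) * pointCount x B ω ∂P := by
  rw [h.lintegral_comp_pointCount_mul_of_subset hA hB hB' hAB hf.measurable,
    ← measure_inter_add_sdiff B hA, Set.inter_eq_right.2 hAB, mul_add]
  gcongr
  exact hf le_self_add

lemma lintegral_pointCount_mul_pointCount (hA : MeasurableSet A) (hA' : ν A ≠ ∞)
    (hB : MeasurableSet B) (hB' : ν B ≠ ∞) :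
    ∫⁻ ω, pointCount x A ω * pointCount x B ω ∂P = ν (A ∩ B) + ν A * ν B := by
  have := h.isProbabilityMeasure
  have hC : MeasurableSet (B ∩ A) := hB.inter hA
  have hC' : ν (B ∩ A) ≠ ∞ := measure_ne_top_of_subset Set.inter_subset_left hB'
  have hmA := h.measurable_pointCount hA
  have hmC := h.measurable_pointCount hC
  have hinter : ∫⁻ ω, pointCount x A ω * pointCount x (B ∩ A) ω ∂P =
      ν (B ∩ A) + ν A * ν (B ∩ A) := by
    simp_rw [mul_comm (pointCount x A _)]
    rw [h.lintegral_comp_pointCount_mul_of_subset (f := fun y => y) hC hA hA' Set.inter_subset_right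
      measurable_id, ← measure_inter_add_sdiff A hC, Set.inter_eq_right.2 Set.inter_subset_right]
    simp only [lintegral_add_right _ measurable_const, h.lintegral_pointCount hC hC',
      lintegral_one, measure_univ]
    ring
  simp_rw [← pointCount_inter_add_diff x B A, mul_add]
  rw [lintegral_add_left (by fun_prop), hinter,
    h.lintegral_comp_pointCount_mul_of_disjoint (f := fun y => y) hA (hB.diff hA)
      (measure_ne_top_of_subset Set.sdiff_subset hB') Set.disjoint_sdiff_right measurable_id,
    ← measure_inter_add_sdiff B hA, Set.inter_comm A]
  simp only [h.lintegral_pointCount hA hA']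
  ring

variable [SigmaFinite ν]

lemma sum_map_eq : Measure.sum (fun i => P.map (x i)) = ν := by
  refine ((finiteMeasureSpanningSets ν).ext
    (generateFrom_setOf_measurableSet_and_measure_ne_top ν).symm
    (isPiSystem_setOf_measurableSet_and_measure_ne_top ν) ?_).symm
  rintro A ⟨hA, hA'⟩
  rw [Measure.sum_apply _ hA, ← h.lintegral_pointCount hA hA']
  simp_rw [pointCount_eq_tsum]
  rw [lintegral_tsum fun i => Measurable.aemeasurable (by
    exact (measurable_const.indicator hA).comp (h.measurable i))]
  refine tsum_congr fun i => ?_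
  rw [Measure.map_apply (h.measurable i) hA, ← lintegral_indicator_one (h.measurable i hA)]
  rfl

lemma sum_map_prodMk_eq :
    Measure.sum (fun p : ℕ × ℕ => if p.1 = p.2 then 0 else P.map fun ω => (x p.1 ω, x p.2 ω)) =
      ν.prod ν := by
  have hgen := generateFrom_setOf_measurableSet_and_measure_ne_top ν
  have hpi := isPiSystem_setOf_measurableSet_and_measure_ne_top ν
  refine (Measure.prod_eq_generateFrom hgen hgen hpi hpi (finiteMeasureSpanningSets ν)
    (finiteMeasureSpanningSets ν) ?_).symm
  rintro A ⟨hA, hA'⟩ B ⟨hB, hB'⟩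
  have hpair (i j : ℕ) : Measurable fun ω => (x i ω, x j ω) :=
    (h.measurable i).prodMk (h.measurable j)
  have hind (i j : ℕ) : Measurable fun ω => if i = j then (0 : ℝ≥0∞) else
      (A ×ˢ B).indicator (fun _ => (1 : ℝ≥0∞)) (x i ω, x j ω) :=
    measurable_const.ite (.const _) ((measurable_const.indicator (hA.prod hB)).comp (hpair i j))
  have hC' : ν (A ∩ B) ≠ ∞ := measure_ne_top_of_subset Set.inter_subset_left hA'
  have hmoment := h.lintegral_pointCount_mul_pointCount hA hA' hB hB'
  simp_rw [pointCount_mul_pointCount] at hmoment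
  rw [lintegral_add_left (h.measurable_pointCount (hA.inter hB)),
    h.lintegral_pointCount (hA.inter hB) hC', ENNReal.add_right_inj hC'] at hmoment
  rw [← hmoment, Measure.sum_apply _ (hA.prod hB), ENNReal.tsum_prod',
    lintegral_tsum fun i => (Measurable.tsum (hind i)).aemeasurable]
  refine tsum_congr fun i => ?_
  rw [lintegral_tsum fun j => (hind i j).aemeasurable]
  refine tsum_congr fun j => ?_
  by_cases hij : i = j
  · simp [hij]
  · simp only [hij, if_false]
    rw [Measure.map_apply (hpair i j) (hA.prod hB),
      ← lintegral_indicator_one (hpair i j (hA.prod hB))]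
    rfl

lemma tsum_lintegral_comp_prodMk {f : S × S → ℝ≥0∞} (hf : Measurable f) :
    ∑' i, ∑' j, (if i = j then 0 else ∫⁻ ω, f (x i ω, x j ω) ∂P) =
      ∫⁻ u, ∫⁻ v, f (u, v) ∂ν ∂ν := by
  rw [← lintegral_prod _ hf.aemeasurable, ← h.sum_map_prodMk_eq, lintegral_sum_measure,
    ENNReal.tsum_prod']
  refine tsum_congr fun i => tsum_congr fun j => ?_
  split_ifs
  · rw [lintegral_zero_measure]
  · rw [lintegral_map hf ((h.measurable i).prodMk (h.measurable j))]

end IsPoissonPointProcess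

/-! ### Edge counts given the weights -/

lemma edgeRate_comm (u : ℕ → unitInterval) (i j : ℕ) : edgeRate u i j = edgeRate u j i := by
  simp only [edgeRate, eq_comm (a := i), mul_comm (unitInterval.toNNReal (u i))]

lemma edgeRate_of_ne (u : ℕ → unitInterval) {i j : ℕ} (hij : i ≠ j) :
    (edgeRate u i j : ℝ) = u i * u j := by
  simp [edgeRate, hij]

lemma coe_edgeRate (u : ℕ → unitInterval) (i j : ℕ) :
    (edgeRate u i j : ℝ≥0∞) =
      if i = j then 0 else ENNReal.ofReal (u i : ℝ) * ENNReal.ofReal (u j : ℝ) := by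
  split_ifs with hij
  · simp [edgeRate, hij]
  · rw [← ENNReal.ofReal_mul (u i).2.1, ← edgeRate_of_ne u hij, ENNReal.ofReal_coe_nnreal]

lemma measurable_edgeRate {Ω : Type*} [MeasurableSpace Ω] {w : ℕ → Ω → unitInterval}
    (hw : ∀ i, Measurable (w i)) (i j : ℕ) : Measurable fun ω => edgeRate (fun k => w k ω) i j := by
  have hc : Measurable unitInterval.toNNReal := unitInterval.toNNReal_continuous.measurable
  unfold edgeRate
  split_ifs
  · exact measurable_const
  · exact (hc.comp (hw i)).mul (hc.comp (hw j))

/-- The multiplicity at time `t` of the edge between the vertices `i` and `j`. -/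
noncomputable def edgeCount {Ω : Type*} (T : ℕ → ℕ → Ω → Set ℝ) (t : ℝ) (i j : ℕ) (ω : Ω) : ℕ∞ :=
  (T i j ω ∩ Set.Icc 0 t).encard

namespace IsPoissonizedGraph

variable {Ω : Type*} [MeasurableSpace Ω] {ν : Measure unitInterval} {P : Measure Ω}
  {w : ℕ → Ω → unitInterval} {T : ℕ → ℕ → Ω → Set ℝ} (hG : IsPoissonizedGraph ν P w T)
include hG

lemma weightSigma_le : weightSigma w ≤ ‹MeasurableSpace Ω› :=
  (measurable_pi_lambda _ hG.weights.measurable).comap_le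

lemma measurable_edgeCount (t : ℝ) (i j : ℕ) : Measurable (edgeCount T t i j) :=
  hG.measurable i j _ measurableSet_Icc

lemma measurableSet_edgeCount_pos (t : ℝ) (i j : ℕ) :
    MeasurableSet {ω | 0 < edgeCount T t i j ω} :=
  hG.measurable_edgeCount t i j (.of_discrete (s := Set.Ioi 0))

lemma measurable_poissonMeasure_edgeRate (t : ℝ) (i j k : ℕ) :
    Measurable fun ω => poissonMeasure (edgeRate (fun l => w l ω) i j * t.toNNReal) {k} := by
  have := measurable_edgeRate hG.weights.measurable i j
  simp_rw [poissonMeasure_singleton]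
  fun_prop

variable {D : Set Ω} (t : ℝ) (i j : ℕ)

lemma measure_inter_edgeCount_eq (hD : MeasurableSet[weightSigma w] D) (k : ℕ) :
    P (D ∩ {ω | edgeCount T t i j ω = k}) =
      ∫⁻ ω in D, poissonMeasure (edgeRate (fun l => w l ω) i j * t.toNNReal) {k} ∂P := by
  wlog hij : i ≤ j generalizing i j
  · simpa only [edgeCount, hG.symm j i, edgeRate_comm _ j i] using this j i (by lia)
  have := hG.weights.isProbabilityMeasure
  have hms : MeasurableSet {ω | edgeCount T t i j ω = k} :=
    hG.measurable_edgeCount t i j (measurableSet_singleton _)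
  have hlaw := hG.conditional_law 1 (fun _ => (i, j)) (fun _ => Set.Icc 0 t) (fun _ => k)
    (fun _ => hij) (fun _ => ⟨measurableSet_Icc, Set.Icc_subset_Ici_self, by simp⟩)
    (fun a b hab => (hab (Subsingleton.elim a b)).elim)
  simp only [forall_const, Fin.prod_const, pow_one, Real.volume_Icc, sub_zero, ENNReal.ofReal,
    ENNReal.toNNReal_coe] at hlaw
  have hint := integrable_condExp.congr hlaw
  have hreal : P.real (D ∩ {ω | edgeCount T t i j ω = k}) =
      ∫ ω in D, (poissonMeasure (edgeRate (fun l => w l ω) i j * t.toNNReal)).real {k} ∂P := by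
    refine Eq.trans ?_ ((setIntegral_condExp hG.weightSigma_le
      ((integrable_const (1 : ℝ)).indicator hms) hD).symm.trans
      (integral_congr_ae (ae_restrict_of_ae hlaw)))
    rw [integral_indicator_const _ hms, smul_eq_mul, mul_one, measureReal_restrict_apply hms,
      Set.inter_comm]
  rw [← ENNReal.ofReal_toReal (measure_ne_top P _), ← measureReal_def, hreal,
    ofReal_integral_eq_lintegral_ofReal hint.restrict (.of_forall fun ω => measureReal_nonneg)]
  simp

lemma ae_edgeCount_ne_top : ∀ᵐ ω ∂P, edgeCount T t i j ω ≠ ⊤ := by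
  have := hG.weights.isProbabilityMeasure
  have hms (k : ℕ) : MeasurableSet {ω | edgeCount T t i j ω = k} :=
    hG.measurable_edgeCount t i j (measurableSet_singleton _)
  have hdisj : Pairwise (Function.onFun Disjoint fun k : ℕ => {ω | edgeCount T t i j ω = k}) :=
    fun a b hab => Set.disjoint_left.2 fun ω (ha : _ = _) (hb : _ = _) =>
      hab (by exact_mod_cast ha.symm.trans hb)
  have hsum : P (⋃ k : ℕ, {ω | edgeCount T t i j ω = k}) = 1 := by
    have htotal (r : ℝ≥0) : ∑' k : ℕ, poissonMeasure r {k} = 1 := by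
      simpa using (lintegral_countable' (μ := poissonMeasure r) fun _ => 1).symm
    have hlaw (k : ℕ) := hG.measure_inter_edgeCount_eq t i j .univ k
    simp only [Set.univ_inter, setLIntegral_univ] at hlaw
    rw [measure_iUnion hdisj hms, tsum_congr hlaw, ← lintegral_tsum fun k =>
      (hG.measurable_poissonMeasure_edgeRate t i j k).aemeasurable]
    simp [htotal]
  rw [← prob_compl_eq_zero_iff (.iUnion hms)] at hsum
  filter_upwards [measure_eq_zero_iff_ae_notMem.1 hsum] with ω hω
  obtain ⟨k, hk⟩ := Set.mem_iUnion.1 (not_not.1 hω)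
  exact ne_of_eq_of_ne hk (ENat.natCast_ne_top k)

lemma setLIntegral_comp_edgeCount (hD : MeasurableSet[weightSigma w] D) (f : ℕ∞ → ℝ≥0∞) :
    ∫⁻ ω in D, f (edgeCount T t i j ω) ∂P =
      ∫⁻ ω in D, ∫⁻ k, f k ∂(poissonMeasure (edgeRate (fun l => w l ω) i j * t.toNNReal)) ∂P := by
  have hms (k : ℕ) : MeasurableSet {ω | edgeCount T t i j ω = k} :=
    hG.measurable_edgeCount t i j (measurableSet_singleton _)
  have hexpand : ∀ᵐ ω ∂P, f (edgeCount T t i j ω) =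
      ∑' k : ℕ, f k * {ω | edgeCount T t i j ω = k}.indicator 1 ω := by
    filter_upwards [hG.ae_edgeCount_ne_top t i j] with ω hω
    obtain ⟨n, hn⟩ := ENat.ne_top_iff_exists.1 hω
    rw [tsum_eq_single n fun k hk => ?_]
    · simp [← hn]
    · simp [← hn, hk.symm]
  simp_rw [lintegral_countable']
  rw [lintegral_congr_ae (ae_restrict_of_ae hexpand), lintegral_tsum fun k =>
    ((measurable_one.indicator (hms k)).const_mul _).aemeasurable, lintegral_tsum fun k =>
    ((hG.measurable_poissonMeasure_edgeRate t i j k).const_mul _).aemeasurable]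
  refine tsum_congr fun k => ?_
  rw [lintegral_const_mul _ (measurable_one.indicator (hms k)),
    lintegral_const_mul _ (hG.measurable_poissonMeasure_edgeRate t i j k),
    lintegral_indicator_one (hms k), Measure.restrict_apply (hms k), Set.inter_comm,
    hG.measure_inter_edgeCount_eq t i j hD]

lemma setLIntegral_edgeCount (hD : MeasurableSet[weightSigma w] D) :
    ∫⁻ ω in D, (edgeCount T t i j ω : ℝ≥0∞) ∂P =
      ENNReal.ofReal t * ∫⁻ ω in D, (edgeRate (fun l => w l ω) i j : ℝ≥0∞) ∂P := by
  have := measurable_edgeRate hG.weights.measurable i j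
  rw [hG.setLIntegral_comp_edgeCount t i j hD, ← lintegral_const_mul _ (by fun_prop)]
  simp [lintegral_natCast_poissonMeasure, mul_comm, ENNReal.ofReal]

lemma lintegral_edgeCount :
    ∫⁻ ω, (edgeCount T t i j ω : ℝ≥0∞) ∂P =
      ENNReal.ofReal t * ∫⁻ ω, (edgeRate (fun l => w l ω) i j : ℝ≥0∞) ∂P := by
  simpa using hG.setLIntegral_edgeCount t i j .univ

lemma measure_inter_edgeCount_pos (hD : MeasurableSet[weightSigma w] D) :
    P (D ∩ {ω | 0 < edgeCount T t i j ω}) = ∫⁻ ω in D, ENNReal.ofReal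
      (1 - Real.exp (-(edgeRate (fun l => w l ω) i j * t.toNNReal : ℝ≥0))) ∂P := by
  have hpos := hG.measurableSet_edgeCount_pos t i j
  have hcompl : ((↑) : ℕ → ℕ∞) ⁻¹' Set.Ioi 0 = {0}ᶜ := by
    ext k
    simp [pos_iff_ne_zero]
  calc P (D ∩ {ω | 0 < edgeCount T t i j ω})
      = ∫⁻ ω in D, (Set.Ioi (0 : ℕ∞)).indicator 1 (edgeCount T t i j ω) ∂P := by
        rw [Set.inter_comm, ← Measure.restrict_apply hpos, ← lintegral_indicator_one hpos]
        rfl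
    _ = ∫⁻ ω in D, poissonMeasure (edgeRate (fun l => w l ω) i j * t.toNNReal) {0}ᶜ ∂P := by
        rw [hG.setLIntegral_comp_edgeCount t i j hD]
        refine lintegral_congr fun ω => ?_
        rw [← hcompl, ← lintegral_indicator_one .of_discrete]
        rfl
    _ = _ := by simp_rw [poissonMeasure_compl_zero]

end IsPoissonizedGraph

/-! ### Expected counts as moments of the rate measure -/

/-- The sum of the weights of the points of a Poisson point process with rate measure `ν` has
expectation `totalWeight ν`. -/
noncomputable def totalWeight (ν : Measure unitInterval) : ℝ≥0∞ :=
  ∫⁻ v, ENNReal.ofReal (v : ℝ) ∂ν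

section Counts

variable {Ω : Type*} (T : ℕ → ℕ → Ω → Set ℝ) (t : ℝ) (ω : Ω)

lemma edgeCount_le_vertexDegree (i j : ℕ) : edgeCount T t i j ω ≤ vertexDegree T t ω i :=
  Set.encard_le_encard
    (Set.inter_subset_inter_left _ (Set.subset_iUnion (fun k => T i k ω) j))

lemma vertexDegree_le_tsum (i : ℕ) :
    (vertexDegree T t ω i : ℝ≥0∞) ≤ ∑' j, (edgeCount T t i j ω : ℝ≥0∞) := by
  simp_rw [vertexDegree, edgeCount, Set.iUnion_inter, ← ENNReal.tsum_set_one]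
  exact ENNReal.tsum_iUnion_le_tsum (fun _ => 1) _

lemma setOf_vertexDegree_pos (i : ℕ) :
    {ω | 0 < vertexDegree T t ω i} = ⋃ j, {ω | 0 < edgeCount T t i j ω} := by
  ext ω
  simp [vertexDegree, edgeCount, pos_iff_ne_zero, Set.iUnion_inter]

lemma numVertices_eq_tsum :
    numVertices T t ω = ∑' i, {ω | 0 < vertexDegree T t ω i}.indicator 1 ω := by
  rw [numVertices, ← ENNReal.tsum_set_one,
    tsum_subtype {i | 0 < vertexDegree T t ω i} fun _ => (1 : ℝ≥0∞)]
  rfl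

lemma binaryDegree_eq_tsum (i : ℕ) :
    (binaryDegree T t ω i : ℝ≥0∞) = ∑' j, {ω | 0 < edgeCount T t i j ω}.indicator 1 ω := by
  rw [binaryDegree, ← ENNReal.tsum_set_one,
    tsum_subtype {j | 0 < (T i j ω ∩ Set.Icc 0 t).encard} fun _ => (1 : ℝ≥0∞)]
  rfl

end Counts

lemma measurableSet_weightSigma {Ω : Type*} (w : ℕ → Ω → unitInterval) (i : ℕ)
    {A : Set unitInterval} (hA : MeasurableSet A) :
    MeasurableSet[weightSigma w] {ω | w i ω ∈ A} :=
  ⟨{u | u i ∈ A}, measurable_pi_apply i hA, rfl⟩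

lemma one_lt_encard_of_two_le_pointCount {S Ω : Type*} {x : ℕ → Ω → S} {A : Set S} {ω : Ω}
    (h : 2 ≤ pointCount x A ω) : 1 < {i | x i ω ∈ A}.encard := by
  have h2 : (2 : ℕ∞) ≤ {i | x i ω ∈ A}.encard := by
    exact ENat.toENNReal_le.1 (by simpa [pointCount] using h)
  exact (Nat.cast_lt.2 one_lt_two).trans_le h2

namespace IsPoissonizedGraph

variable {Ω : Type*} [MeasurableSpace Ω] {ν : Measure unitInterval} {P : Measure Ω}
  {w : ℕ → Ω → unitInterval} {T : ℕ → ℕ → Ω → Set ℝ} (hG : IsPoissonizedGraph ν P w T)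
include hG

lemma measurable_coe_edgeCount (t : ℝ) (i j : ℕ) :
    Measurable fun ω => (edgeCount T t i j ω : ℝ≥0∞) :=
  (measurable_of_countable _).comp (hG.measurable_edgeCount t i j)

lemma measurableSet_vertexDegree_pos (t : ℝ) (i : ℕ) :
    MeasurableSet {ω | 0 < vertexDegree T t ω i} := by
  rw [setOf_vertexDegree_pos]
  exact .iUnion fun j => hG.measurableSet_edgeCount_pos t i j

lemma lintegral_numVertices (t : ℝ) :
    ∫⁻ ω, numVertices T t ω ∂P = ∑' i, P {ω | 0 < vertexDegree T t ω i} := by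
  simp_rw [numVertices_eq_tsum]
  rw [lintegral_tsum fun i =>
    (measurable_one.indicator (hG.measurableSet_vertexDegree_pos t i)).aemeasurable]
  exact tsum_congr fun i => lintegral_indicator_one (hG.measurableSet_vertexDegree_pos t i)

lemma measure_edgeCount_pos_le (t : ℝ) (i j : ℕ) :
    P {ω | 0 < edgeCount T t i j ω} ≤ if i = j then 0 else
      ∫⁻ ω, min 1 (ENNReal.ofReal t *
        (ENNReal.ofReal (w i ω : ℝ) * ENNReal.ofReal (w j ω : ℝ))) ∂P := by
  have hexp (r : ℝ≥0) : ENNReal.ofReal (1 - Real.exp (-r)) ≤ min 1 (r : ℝ≥0∞) := by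
    rw [← ENNReal.ofReal_one, ← ENNReal.ofReal_coe_nnreal]
    exact le_min (ENNReal.ofReal_le_ofReal (by linarith [Real.exp_pos (-r)]))
      (ENNReal.ofReal_le_ofReal (by linarith [Real.add_one_le_exp (-(r : ℝ))]))
  calc P {ω | 0 < edgeCount T t i j ω}
      = ∫⁻ ω, ENNReal.ofReal
          (1 - Real.exp (-(edgeRate (fun l => w l ω) i j * t.toNNReal : ℝ≥0))) ∂P := by
        simpa using hG.measure_inter_edgeCount_pos t i j .univ
    _ ≤ ∫⁻ ω, min 1 (ENNReal.ofReal t * (edgeRate (fun l => w l ω) i j : ℝ≥0∞)) ∂P := by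
        refine lintegral_mono fun ω => (hexp _).trans_eq ?_
        rw [ENNReal.coe_mul, mul_comm, ENNReal.ofReal]
    _ = _ := by
        simp_rw [coe_edgeRate]
        split_ifs <;> simp

lemma measure_vertexDegree_pos_le (t : ℝ) (i : ℕ) {A : Set unitInterval} (hA : MeasurableSet A) :
    P {ω | 0 < vertexDegree T t ω i} ≤ P {ω | w i ω ∈ A} +
      ENNReal.ofReal t * ∑' j, ∫⁻ ω in {ω | w i ω ∈ Aᶜ},
        (edgeRate (fun l => w l ω) i j : ℝ≥0∞) ∂P := by
  have hpos := hG.measurableSet_vertexDegree_pos t i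
  have hle (ω : Ω) : {ω | 0 < vertexDegree T t ω i}.indicator 1 ω ≤
      ∑' j, (edgeCount T t i j ω : ℝ≥0∞) := by
    refine le_trans ?_ (vertexDegree_le_tsum T t ω i)
    rcases eq_zero_or_pos (vertexDegree T t ω i) with hω | hω
    · simp [hω]
    · rw [Set.indicator_apply, if_pos (show _ ∈ {ω | 0 < vertexDegree T t ω i} from hω),
        Pi.one_apply]
      exact_mod_cast Order.one_le_iff_pos.2 hω
  calc P {ω | 0 < vertexDegree T t ω i}
      ≤ P {ω | w i ω ∈ A} + P ({ω | 0 < vertexDegree T t ω i} ∩ {ω | w i ω ∈ Aᶜ}) := by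
        refine (measure_mono fun ω hω => ?_).trans (measure_union_le _ _)
        by_cases hi : w i ω ∈ A
        exacts [Or.inl hi, Or.inr ⟨hω, hi⟩]
    _ ≤ P {ω | w i ω ∈ A} +
        ∫⁻ ω in {ω | w i ω ∈ Aᶜ}, ∑' j, (edgeCount T t i j ω : ℝ≥0∞) ∂P := by
        rw [← Measure.restrict_apply hpos, ← lintegral_indicator_one hpos]
        gcongr
        exact hle _
    _ = _ := by
        rw [lintegral_tsum fun j => (hG.measurable_coe_edgeCount t i j).aemeasurable]
        simp_rw [hG.setLIntegral_edgeCount t i _ (measurableSet_weightSigma w i hA.compl),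
          ENNReal.tsum_mul_left]

section UpperBounds

variable [SigmaFinite ν]

lemma tsum_setLIntegral_edgeRate {A : Set unitInterval} (hA : MeasurableSet A) :
    ∑' i, ∑' j, ∫⁻ ω in {ω | w i ω ∈ A}, (edgeRate (fun l => w l ω) i j : ℝ≥0∞) ∂P =
      totalWeight (ν.restrict A) * totalWeight ν := by
  have hm : Measurable fun v : unitInterval => ENNReal.ofReal (v : ℝ) := by fun_prop
  have hpair := hG.weights.tsum_lintegral_comp_prodMk (f := fun p =>
    A.indicator (fun v => ENNReal.ofReal (v : ℝ)) p.1 * ENNReal.ofReal (p.2 : ℝ))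
    (((hm.indicator hA).comp measurable_fst).mul (hm.comp measurable_snd))
  simp_rw [lintegral_const_mul _ hm, lintegral_mul_const _ (hm.indicator hA),
    lintegral_indicator hA] at hpair
  rw [totalWeight, totalWeight, ← hpair]
  refine tsum_congr fun i => tsum_congr fun j => ?_
  simp_rw [coe_edgeRate]
  split_ifs with hij
  · simp
  · have hi : MeasurableSet {ω | w i ω ∈ A} := hG.weights.measurable i hA
    rw [← lintegral_indicator hi]
    refine lintegral_congr fun ω => ?_
    by_cases hω : w i ω ∈ A <;> simp [hω]

lemma tsum_lintegral_edgeRate :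
    ∑' i, ∑' j, ∫⁻ ω, (edgeRate (fun l => w l ω) i j : ℝ≥0∞) ∂P =
      totalWeight ν * totalWeight ν := by
  simpa using hG.tsum_setLIntegral_edgeRate .univ

lemma lintegral_numEdges_le (t : ℝ) :
    ∫⁻ ω, numEdges T t ω ∂P ≤ 2⁻¹ * (ENNReal.ofReal t * (totalWeight ν * totalWeight ν)) := by
  have hm := hG.measurable_coe_edgeCount t
  calc ∫⁻ ω, numEdges T t ω ∂P
      ≤ ∫⁻ ω, 2⁻¹ * ∑' i, ∑' j, (edgeCount T t i j ω : ℝ≥0∞) ∂P := by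
        unfold numEdges
        gcongr
        exact vertexDegree_le_tsum T t _ _
    _ = 2⁻¹ * ∑' i, ∑' j, ∫⁻ ω, (edgeCount T t i j ω : ℝ≥0∞) ∂P := by
        rw [lintegral_const_mul' _ _ (by simp),
          lintegral_tsum fun i => (Measurable.tsum (hm i)).aemeasurable]
        simp_rw [lintegral_tsum fun j => (hm _ j).aemeasurable]
    _ = 2⁻¹ * (ENNReal.ofReal t * (totalWeight ν * totalWeight ν)) := by
        simp_rw [hG.lintegral_edgeCount, ENNReal.tsum_mul_left, hG.tsum_lintegral_edgeRate]

lemma lintegral_numVertices_le (t : ℝ) {A : Set unitInterval} (hA : MeasurableSet A) :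
    ∫⁻ ω, numVertices T t ω ∂P ≤
      ν A + ENNReal.ofReal t * (totalWeight (ν.restrict Aᶜ) * totalWeight ν) := by
  have hcount : ∑' i, P {ω | w i ω ∈ A} = ν A := by
    conv_rhs => rw [← hG.weights.sum_map_eq, Measure.sum_apply _ hA]
    exact tsum_congr fun i => (Measure.map_apply (hG.weights.measurable i) hA).symm
  calc ∫⁻ ω, numVertices T t ω ∂P
      = ∑' i, P {ω | 0 < vertexDegree T t ω i} := hG.lintegral_numVertices t
    _ ≤ ∑' i, (P {ω | w i ω ∈ A} + ENNReal.ofReal t * ∑' j, ∫⁻ ω in {ω | w i ω ∈ Aᶜ},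
          (edgeRate (fun l => w l ω) i j : ℝ≥0∞) ∂P) :=
        ENNReal.tsum_le_tsum fun i => hG.measure_vertexDegree_pos_le t i hA
    _ = _ := by
        rw [ENNReal.tsum_add, hcount, ENNReal.tsum_mul_left,
          hG.tsum_setLIntegral_edgeRate hA.compl]

lemma lintegral_numBinaryEdges_le (t : ℝ) :
    ∫⁻ ω, numBinaryEdges T t ω ∂P ≤ 2⁻¹ * ∫⁻ u, ∫⁻ v, min 1 (ENNReal.ofReal t *
      (ENNReal.ofReal (u : ℝ) * ENNReal.ofReal (v : ℝ))) ∂ν ∂ν := by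
  have hpos (i j : ℕ) := hG.measurableSet_edgeCount_pos t i j
  have hm (i j : ℕ) : Measurable fun ω =>
      {ω | 0 < edgeCount T t i j ω}.indicator (1 : Ω → ℝ≥0∞) ω :=
    measurable_one.indicator (hpos i j)
  calc ∫⁻ ω, numBinaryEdges T t ω ∂P
      = 2⁻¹ * ∑' i, ∑' j, P {ω | 0 < edgeCount T t i j ω} := by
        simp_rw [numBinaryEdges, binaryDegree_eq_tsum]
        rw [lintegral_const_mul' _ _ (by simp),
          lintegral_tsum fun i => (Measurable.tsum (hm i)).aemeasurable]
        simp_rw [lintegral_tsum fun j => (hm _ j).aemeasurable]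
        exact congrArg _ (tsum_congr fun i => tsum_congr fun j =>
          lintegral_indicator_one (hpos i j))
    _ ≤ 2⁻¹ * ∑' i, ∑' j, (if i = j then 0 else ∫⁻ ω, min 1 (ENNReal.ofReal t *
          (ENNReal.ofReal (w i ω : ℝ) * ENNReal.ofReal (w j ω : ℝ))) ∂P) := by
        gcongr with i j
        exact hG.measure_edgeCount_pos_le t i j
    _ = _ := by
        rw [hG.weights.tsum_lintegral_comp_prodMk (f := fun p => min 1 (ENNReal.ofReal t *
          (ENNReal.ofReal (p.1 : ℝ) * ENNReal.ofReal (p.2 : ℝ)))) (by fun_prop)]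

end UpperBounds

section LowerBounds

lemma exists_mul_le_lintegral_numEdges [SigmaFinite ν] (hν : totalWeight ν ≠ 0) :
    ∃ c : ℝ≥0∞, c ≠ 0 ∧ ∀ t : ℝ, c * ENNReal.ofReal t ≤ ∫⁻ ω, numEdges T t ω ∂P := by
  obtain ⟨i, j, hij⟩ : ∃ i j, ∫⁻ ω, (edgeRate (fun l => w l ω) i j : ℝ≥0∞) ∂P ≠ 0 := by
    by_contra! hzero
    simpa [hzero, hν] using hG.tsum_lintegral_edgeRate
  refine ⟨2⁻¹ * ∫⁻ ω, (edgeRate (fun l => w l ω) i j : ℝ≥0∞) ∂P,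
    mul_ne_zero (by simp) hij, fun t => ?_⟩
  calc 2⁻¹ * (∫⁻ ω, (edgeRate (fun l => w l ω) i j : ℝ≥0∞) ∂P) * ENNReal.ofReal t
      = ∫⁻ ω, 2⁻¹ * (edgeCount T t i j ω : ℝ≥0∞) ∂P := by
        rw [lintegral_const_mul' _ _ (by simp), hG.lintegral_edgeCount, mul_assoc, mul_comm _
          (ENNReal.ofReal t)]
    _ ≤ ∫⁻ ω, numEdges T t ω ∂P := by
        unfold numEdges
        gcongr
        refine le_trans ?_ (ENNReal.le_tsum i)
        exact_mod_cast edgeCount_le_vertexDegree T t _ i j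

variable {A B : Set unitInterval} {c t : ℝ}

/-- The events that `i` is joined to `j`, where `j` is the first vertex other than `i` with weight
in `A`, are disjoint, and the choice of `j` depends on the weights only. -/
lemma ofReal_mul_measure_le_measure_vertexDegree_pos (hA : MeasurableSet A) (hB : MeasurableSet B)
    (hc : ∀ u ∈ B, ∀ v ∈ A, c ≤ u * v * t.toNNReal) (i : ℕ) :
    ENNReal.ofReal (1 - Real.exp (-c)) * P {ω | w i ω ∈ B ∧ 2 ≤ pointCount w A ω} ≤
      P {ω | 0 < vertexDegree T t ω i} := by
  let s (j : ℕ) : Set Ω := {_ω | i ≠ j} ∩ ({ω | w i ω ∈ B} ∩ {ω | w j ω ∈ A})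
  have hs (j : ℕ) : MeasurableSet[weightSigma w] (disjointed s j) :=
    MeasurableSet.disjointed (fun j => .inter (.const _)
      (.inter (measurableSet_weightSigma w i hB) (measurableSet_weightSigma w j hA))) j
  have hs' (j : ℕ) : MeasurableSet (disjointed s j) := hG.weightSigma_le _ (hs j)
  have hpos (j : ℕ) := hG.measurableSet_edgeCount_pos t i j
  have hcover : {ω | w i ω ∈ B ∧ 2 ≤ pointCount w A ω} ⊆ ⋃ j, disjointed s j := by
    rintro ω ⟨hi, hω⟩
    obtain ⟨j, hj, hji⟩ := Set.exists_ne_of_one_lt_encard (one_lt_encard_of_two_le_pointCount hω) i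
    rw [iUnion_disjointed]
    exact Set.mem_iUnion.2 ⟨j, hji.symm, hi, hj⟩
  have hjoin (j : ℕ) : ENNReal.ofReal (1 - Real.exp (-c)) * P (disjointed s j) ≤
      P (disjointed s j ∩ {ω | 0 < edgeCount T t i j ω}) := by
    rw [hG.measure_inter_edgeCount_pos t i j (hs j), ← setLIntegral_const]
    refine setLIntegral_mono' (hs' j) fun ω hω => ?_
    obtain ⟨hij, hi, hj⟩ := disjointed_subset s j hω
    rw [NNReal.coe_mul, edgeRate_of_ne _ hij]
    gcongr
    exact hc _ hi _ hj
  calc ENNReal.ofReal (1 - Real.exp (-c)) * P {ω | w i ω ∈ B ∧ 2 ≤ pointCount w A ω}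
      ≤ ∑' j, ENNReal.ofReal (1 - Real.exp (-c)) * P (disjointed s j) := by
        rw [ENNReal.tsum_mul_left]
        gcongr
        exact (measure_mono hcover).trans (measure_iUnion_le _)
    _ ≤ ∑' j, P (disjointed s j ∩ {ω | 0 < edgeCount T t i j ω}) := ENNReal.tsum_le_tsum hjoin
    _ = P (⋃ j, disjointed s j ∩ {ω | 0 < edgeCount T t i j ω}) :=
        (measure_iUnion (fun j k hjk => ((disjoint_disjointed s hjk).mono Set.inter_subset_left
          Set.inter_subset_left)) fun j => (hs' j).inter (hpos j)).symm
    _ ≤ P {ω | 0 < vertexDegree T t ω i} := by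
        rw [setOf_vertexDegree_pos]
        exact measure_mono (Set.iUnion_mono fun j => Set.inter_subset_right)

lemma le_lintegral_numVertices (hA : MeasurableSet A) (hB : MeasurableSet B) (hB' : ν B ≠ ∞)
    (hAB : A ⊆ B) (hc : ∀ u ∈ B, ∀ v ∈ A, c ≤ u * v * t.toNNReal) :
    ENNReal.ofReal (1 - Real.exp (-c)) * poissonMeasure (ν A).toNNReal (Set.Ici 2) * ν B ≤
      ∫⁻ ω, numVertices T t ω ∂P := by
  have hw := hG.weights
  have hmA := hw.measurable_pointCount hA
  have hlaw : ∫⁻ ω, (Set.Ici (2 : ℝ≥0∞)).indicator 1 (pointCount w A ω) ∂P =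
      poissonMeasure (ν A).toNNReal (Set.Ici 2) := by
    rw [hw.lintegral_comp_pointCount hA (measure_ne_top_of_subset hAB hB')
      (measurable_one.indicator measurableSet_Ici),
      ← lintegral_indicator_one (μ := poissonMeasure (ν A).toNNReal) .of_discrete]
    refine lintegral_congr fun k => ?_
    simp [Set.indicator_apply]
  have hmono : Monotone ((Set.Ici (2 : ℝ≥0∞)).indicator (1 : ℝ≥0∞ → ℝ≥0∞)) := fun a b hab => by
    by_cases ha : 2 ≤ a
    · simp [ha, ha.trans hab]
    · simp [ha]
  have hevent (i : ℕ) : MeasurableSet {ω | w i ω ∈ B ∧ 2 ≤ pointCount w A ω} :=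
    (hw.measurable i hB).inter (hmA measurableSet_Ici)
  rw [mul_assoc, hG.lintegral_numVertices t]
  calc ENNReal.ofReal (1 - Real.exp (-c)) * (poissonMeasure (ν A).toNNReal (Set.Ici 2) * ν B)
      ≤ ENNReal.ofReal (1 - Real.exp (-c)) * ∫⁻ ω,
          (Set.Ici (2 : ℝ≥0∞)).indicator 1 (pointCount w A ω) * pointCount w B ω ∂P := by
        rw [← hlaw]
        gcongr
        exact hw.lintegral_comp_pointCount_mul_le hA hB hB' hAB hmono
    _ = ∑' i, ENNReal.ofReal (1 - Real.exp (-c)) *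
          P {ω | w i ω ∈ B ∧ 2 ≤ pointCount w A ω} := by
        simp_rw [ENNReal.tsum_mul_left, ← lintegral_indicator_one (hevent _)]
        rw [← lintegral_tsum fun i => (measurable_one.indicator (hevent i)).aemeasurable]
        congr 1
        refine lintegral_congr fun ω => ?_
        rw [pointCount_eq_tsum w B, ← ENNReal.tsum_mul_left]
        refine tsum_congr fun i => ?_
        by_cases hi : w i ω ∈ B <;> by_cases hω : 2 ≤ pointCount w A ω <;> simp [hi, hω]
    _ ≤ ∑' i, P {ω | 0 < vertexDegree T t ω i} := ENNReal.tsum_le_tsum fun i =>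
        hG.ofReal_mul_measure_le_measure_vertexDegree_pos hA hB hc i

end LowerBounds

end IsPoissonizedGraph

/-! ### Truncation of the weights -/

section Truncation

variable {S : Type*} [MeasurableSpace S] {ν : Measure S} {f : S → ℝ≥0∞} {A : Set S}

lemma lintegral_min_one_mul_le (hf : Measurable f) (hA : MeasurableSet A) (s : ℝ≥0∞) :
    ∫⁻ v, min 1 (s * f v) ∂ν ≤ ν A + s * ∫⁻ v in Aᶜ, f v ∂ν := by
  rw [← lintegral_add_compl _ hA, ← setLIntegral_one, ← lintegral_const_mul _ hf]
  gcongr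
  exacts [min_le_left _ _, min_le_right _ _]

lemma lintegral_lintegral_min_one_le_of_truncation (hf : Measurable f) (hA : MeasurableSet A)
    (t : ℝ≥0∞) :
    ∫⁻ u, ∫⁻ v, min 1 (t * (f u * f v)) ∂ν ∂ν ≤
      ν A * ν A + 2 * (t * ((∫⁻ v in Aᶜ, f v ∂ν) * ∫⁻ v, f v ∂ν)) := by
  have hlight (u : S) : ∫⁻ v, min 1 (t * (f u * f v)) ∂ν ≤ t * (f u * ∫⁻ v, f v ∂ν) := by
    simpa [mul_assoc] using lintegral_min_one_mul_le hf (ν := ν) .empty (t * f u)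
  have hheavy (u : S) : ∫⁻ v, min 1 (t * (f u * f v)) ∂ν ≤
      ν A + t * (f u * ∫⁻ v in Aᶜ, f v ∂ν) := by
    simpa [mul_assoc] using lintegral_min_one_mul_le hf (ν := ν) hA (t * f u)
  calc ∫⁻ u, ∫⁻ v, min 1 (t * (f u * f v)) ∂ν ∂ν
      ≤ ∫⁻ u in A, (ν A + t * (f u * ∫⁻ v in Aᶜ, f v ∂ν)) ∂ν +
          ∫⁻ u in Aᶜ, t * (f u * ∫⁻ v, f v ∂ν) ∂ν := by
        rw [← lintegral_add_compl _ hA]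
        gcongr
        exacts [hheavy _, hlight _]
    _ = ν A * ν A + t * ((∫⁻ u in A, f u ∂ν) * ∫⁻ v in Aᶜ, f v ∂ν) +
          t * ((∫⁻ u in Aᶜ, f u ∂ν) * ∫⁻ v, f v ∂ν) := by
        rw [lintegral_add_left measurable_const, setLIntegral_const,
          lintegral_const_mul _ (hf.mul_const _), lintegral_const_mul _ (hf.mul_const _),
          lintegral_mul_const _ hf, lintegral_mul_const _ hf]
    _ ≤ ν A * ν A + t * ((∫⁻ v in Aᶜ, f v ∂ν) * ∫⁻ v, f v ∂ν) +
          t * ((∫⁻ v in Aᶜ, f v ∂ν) * ∫⁻ v, f v ∂ν) := by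
        rw [mul_comm (∫⁻ u in A, f u ∂ν)]
        gcongr
        exact Measure.restrict_le_self
    _ = _ := by ring

lemma lintegral_lintegral_min_one_le_of_le_one (hf : Measurable f) (hf1 : ∀ v, f v ≤ 1)
    (hA : MeasurableSet A) (t : ℝ≥0∞) :
    ∫⁻ u, ∫⁻ v, min 1 (t * (f u * f v)) ∂ν ∂ν ≤
      2 * (ν A * ∫⁻ v, min 1 (t * f v) ∂ν) +
        t * ((∫⁻ v in Aᶜ, f v ∂ν) * ∫⁻ v in Aᶜ, f v ∂ν) := by
  have hlight (u : S) : ∫⁻ v, min 1 (t * (f u * f v)) ∂ν ≤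
      min 1 (t * f u) * ν A + t * (f u * ∫⁻ v in Aᶜ, f v ∂ν) := by
    rw [← lintegral_add_compl _ hA, ← setLIntegral_const, ← lintegral_const_mul _ hf,
      ← lintegral_const_mul _ (hf.const_mul _)]
    gcongr
    exacts [mul_le_of_le_one_right' (hf1 _), min_le_right _ _]
  calc ∫⁻ u, ∫⁻ v, min 1 (t * (f u * f v)) ∂ν ∂ν
      ≤ ∫⁻ _ in A, ∫⁻ v, min 1 (t * f v) ∂ν ∂ν +
          ∫⁻ u in Aᶜ, (min 1 (t * f u) * ν A + t * (f u * ∫⁻ v in Aᶜ, f v ∂ν)) ∂ν := by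
        rw [← lintegral_add_compl _ hA]
        gcongr
        exacts [mul_le_of_le_one_left' (hf1 _), hlight _]
    _ = (∫⁻ v, min 1 (t * f v) ∂ν) * ν A + ((∫⁻ u in Aᶜ, min 1 (t * f u) ∂ν) * ν A +
          t * ((∫⁻ v in Aᶜ, f v ∂ν) * ∫⁻ v in Aᶜ, f v ∂ν)) := by
        rw [setLIntegral_const, lintegral_add_left (by fun_prop),
          lintegral_mul_const _ (by fun_prop), lintegral_const_mul _ (hf.mul_const _),
          lintegral_mul_const _ hf]
    _ ≤ (∫⁻ v, min 1 (t * f v) ∂ν) * ν A + ((∫⁻ v, min 1 (t * f v) ∂ν) * ν A +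
          t * ((∫⁻ v in Aᶜ, f v ∂ν) * ∫⁻ v in Aᶜ, f v ∂ν)) := by
        gcongr
        exact Measure.restrict_le_self
    _ = _ := by ring

end Truncation

section Tail

/-- The tail `ν [x, 1]`, the expected number of vertices of weight at least `x`. -/
noncomputable def upperTail (ν : Measure unitInterval) (x : ℝ) : ℝ≥0∞ :=
  ν {v : unitInterval | x ≤ (v : ℝ)}

/-- The truncated first moment of `ν`, the expected total weight of the vertices of weight less
than `x`. -/
noncomputable def lowerWeight (ν : Measure unitInterval) (x : ℝ) : ℝ≥0∞ :=
  totalWeight (ν.restrict {v : unitInterval | x ≤ (v : ℝ)}ᶜ)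

/-- The conclusion of Karamata's theorem that the asymptotics of the graph depend on: near `0` the
truncated first moment of `ν` is at most of the order of `x ν [x, 1]`, where the tail `ν [x, 1]` is
neither `0` nor `∞`. -/
structure HasKaramataBound (ν : Measure unitInterval) : Prop where
  eventually_upperTail_ne_zero : ∀ᶠ x in 𝓝[>] 0, upperTail ν x ≠ 0
  eventually_upperTail_ne_top : ∀ᶠ x in 𝓝[>] 0, upperTail ν x ≠ ∞
  exists_lowerWeight_le : ∃ C : ℝ≥0∞, C ≠ ∞ ∧
    ∀ᶠ x in 𝓝[>] 0, lowerWeight ν x ≤ C * (ENNReal.ofReal x * upperTail ν x)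

variable {ν : Measure unitInterval}

lemma measurableSet_setOf_le_coe (x : ℝ) : MeasurableSet {v : unitInterval | x ≤ (v : ℝ)} :=
  measurableSet_le measurable_const measurable_subtype_coe

lemma upperTail_antitone (ν : Measure unitInterval) : Antitone (upperTail ν) :=
  fun _ _ hxy => measure_mono fun _ hv => hxy.trans hv

lemma ofReal_mul_upperTail_le (x : ℝ) : ENNReal.ofReal x * upperTail ν x ≤ totalWeight ν := by
  refine le_trans ?_ (mul_meas_ge_le_lintegral (by fun_prop) (ENNReal.ofReal x))
  gcongr
  exact measure_mono fun v hv => ENNReal.ofReal_le_ofReal hv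

lemma ofReal_mul_ofReal_inv {s : ℝ} (hs : 0 < s) : ENNReal.ofReal s * ENNReal.ofReal s⁻¹ = 1 := by
  rw [← ENNReal.ofReal_mul hs.le, mul_inv_cancel₀ hs.ne', ENNReal.ofReal_one]

lemma upperTail_inv_le {s : ℝ} (hs : 0 < s) :
    upperTail ν s⁻¹ ≤ ENNReal.ofReal s * totalWeight ν :=
  calc upperTail ν s⁻¹
      = ENNReal.ofReal s * (ENNReal.ofReal s⁻¹ * upperTail ν s⁻¹) := by
        rw [← mul_assoc, ofReal_mul_ofReal_inv hs, one_mul]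
    _ ≤ ENNReal.ofReal s * totalWeight ν := by
        gcongr
        exact ofReal_mul_upperTail_le _

lemma totalWeight_le (x : ℝ) : totalWeight ν ≤ upperTail ν x + lowerWeight ν x := by
  rw [totalWeight, ← lintegral_add_compl _ (measurableSet_setOf_le_coe x), upperTail,
    ← setLIntegral_one]
  gcongr with v
  · exact ENNReal.ofReal_le_one.2 v.2.2
  · exact le_rfl

namespace HasKaramataBound

variable (hν : HasKaramataBound ν)
include hν

lemma upperTail_ne_top {x : ℝ} (hx : 0 < x) : upperTail ν x ≠ ∞ := by
  obtain ⟨y, hy, hyx⟩ := (hν.eventually_upperTail_ne_top.and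
    (nhdsWithin_le_nhds (eventually_le_nhds hx))).exists
  exact ne_top_of_le_ne_top hy (upperTail_antitone ν hyx)

lemma exists_upperTail_ne_zero : ∃ x, 0 < x ∧ upperTail ν x ≠ 0 :=
  (eventually_mem_nhdsWithin.and hν.eventually_upperTail_ne_zero).exists

lemma totalWeight_ne_top : totalWeight ν ≠ ∞ := by
  obtain ⟨C, hC, hle⟩ := hν.exists_lowerWeight_le
  obtain ⟨x, hx, hx_top⟩ := (hle.and hν.eventually_upperTail_ne_top).exists
  exact ne_top_of_le_ne_top (by finiteness) ((totalWeight_le x).trans (add_le_add_right hx _))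

lemma lowerWeight_ne_top (x : ℝ) : lowerWeight ν x ≠ ∞ :=
  ne_top_of_le_ne_top hν.totalWeight_ne_top (lintegral_mono' Measure.restrict_le_self le_rfl)

lemma totalWeight_ne_zero : totalWeight ν ≠ 0 := by
  obtain ⟨x, hx, hx0⟩ := hν.exists_upperTail_ne_zero
  exact (lt_of_lt_of_le (ENNReal.mul_pos (by simpa using hx) hx0)
    (ofReal_mul_upperTail_le x)).ne'

lemma exists_ofReal_mul_lowerWeight_inv_le : ∃ C : ℝ≥0∞, C ≠ ∞ ∧
    ∀ᶠ s : ℝ in atTop, ENNReal.ofReal s * lowerWeight ν s⁻¹ ≤ C * upperTail ν s⁻¹ := by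
  obtain ⟨C, hC, hle⟩ := hν.exists_lowerWeight_le
  refine ⟨C, hC, ?_⟩
  filter_upwards [tendsto_inv_atTop_nhdsGT_zero.eventually hle, eventually_gt_atTop 0]
    with s hs hs0
  calc ENNReal.ofReal s * lowerWeight ν s⁻¹
      ≤ ENNReal.ofReal s * (C * (ENNReal.ofReal s⁻¹ * upperTail ν s⁻¹)) := by gcongr
    _ = C * ((ENNReal.ofReal s * ENNReal.ofReal s⁻¹) * upperTail ν s⁻¹) := by ring
    _ = C * upperTail ν s⁻¹ := by rw [ofReal_mul_ofReal_inv hs0, one_mul]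

end HasKaramataBound

end Tail

/-! ### Expected counts in terms of the tail -/

lemma isBigO_toReal_of_eventually_le {ι : Type*} {F : Filter ι} {a b : ι → ℝ≥0∞} {K : ℝ≥0∞}
    (hK : K ≠ ∞) (hb : ∀ᶠ t in F, b t ≠ ∞) (h : ∀ᶠ t in F, a t ≤ K * b t) :
    (fun t => (a t).toReal) =O[F] fun t => (b t).toReal := by
  refine IsBigO.of_bound K.toReal ?_
  filter_upwards [hb, h] with t ht hle
  rw [Real.norm_of_nonneg ENNReal.toReal_nonneg, Real.norm_of_nonneg ENNReal.toReal_nonneg,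
    ← ENNReal.toReal_mul]
  exact ENNReal.toReal_mono (ENNReal.mul_ne_top hK ht) hle

lemma isBigO_toReal_of_eventually_mul_le {ι : Type*} {F : Filter ι} {a b : ι → ℝ≥0∞} {k : ℝ≥0∞}
    (hk : k ≠ 0) (hb : ∀ᶠ t in F, b t ≠ ∞) (h : ∀ᶠ t in F, k * a t ≤ b t) :
    (fun t => (a t).toReal) =O[F] fun t => (b t).toReal := by
  refine isBigO_toReal_of_eventually_le (ENNReal.inv_ne_top.2 hk) hb ?_
  filter_upwards [hb, h] with t ht hle
  rw [mul_comm, ← div_eq_mul_inv, ENNReal.le_div_iff_mul_le (Or.inl hk) (Or.inr ht), mul_comm]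
  exact hle

lemma poissonMeasure_Ici_ne_zero {r : ℝ≥0} (hr : r ≠ 0) (n : ℕ) :
    poissonMeasure r (Set.Ici n) ≠ 0 := by
  have hn : poissonMeasure r {n} ≠ 0 := fun h =>
    (poissonMeasure_real_singleton_pos n (pos_iff_ne_zero.2 hr)).ne' (by simp [Measure.real, h])
  exact fun h => hn (measure_mono_null (Set.singleton_subset_iff.2 Set.self_mem_Ici) h)

lemma ofReal_eq_ofReal_sqrt_mul_self {t : ℝ} (ht : 0 ≤ t) :
    ENNReal.ofReal t = ENNReal.ofReal √t * ENNReal.ofReal √t := by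
  rw [← ENNReal.ofReal_mul (Real.sqrt_nonneg t), Real.mul_self_sqrt ht]

namespace IsPoissonizedGraph

variable {Ω : Type*} [MeasurableSpace Ω] {ν : Measure unitInterval} [SigmaFinite ν]
  {P : Measure Ω} {w : ℕ → Ω → unitInterval} {T : ℕ → ℕ → Ω → Set ℝ}
  (hG : IsPoissonizedGraph ν P w T)
include hG

lemma lintegral_numVertices_le_upperTail_add (t x : ℝ) :
    ∫⁻ ω, numVertices T t ω ∂P ≤
      upperTail ν x + ENNReal.ofReal t * (lowerWeight ν x * totalWeight ν) :=
  hG.lintegral_numVertices_le t (measurableSet_setOf_le_coe x)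

lemma lintegral_numBinaryEdges_le_lintegral_lintegral (t : ℝ) :
    ∫⁻ ω, numBinaryEdges T t ω ∂P ≤ ∫⁻ u, ∫⁻ v, min 1 (ENNReal.ofReal t *
      (ENNReal.ofReal (u : ℝ) * ENNReal.ofReal (v : ℝ))) ∂ν ∂ν :=
  (hG.lintegral_numBinaryEdges_le t).trans (mul_le_of_le_one_left' (by simp))

lemma lintegral_numBinaryEdges_le_upperTail_sq_add (t x : ℝ) :
    ∫⁻ ω, numBinaryEdges T t ω ∂P ≤ upperTail ν x * upperTail ν x +
      2 * (ENNReal.ofReal t * (lowerWeight ν x * totalWeight ν)) :=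
  (hG.lintegral_numBinaryEdges_le_lintegral_lintegral t).trans
    (lintegral_lintegral_min_one_le_of_truncation (by fun_prop) (measurableSet_setOf_le_coe x) _)

lemma lintegral_numBinaryEdges_le_upperTail_mul_add (t x y : ℝ) :
    ∫⁻ ω, numBinaryEdges T t ω ∂P ≤
      2 * (upperTail ν x * (upperTail ν y + ENNReal.ofReal t * lowerWeight ν y)) +
        ENNReal.ofReal t * (lowerWeight ν x * lowerWeight ν x) := by
  have hm : Measurable fun v : unitInterval => ENNReal.ofReal (v : ℝ) := by fun_prop
  refine (hG.lintegral_numBinaryEdges_le_lintegral_lintegral t).trans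
    ((lintegral_lintegral_min_one_le_of_le_one hm (fun v => ENNReal.ofReal_le_one.2 v.2.2)
      (measurableSet_setOf_le_coe x) _).trans ?_)
  gcongr
  exacts [le_rfl, lintegral_min_one_mul_le hm (measurableSet_setOf_le_coe y) _, le_rfl, le_rfl]

variable (hν : HasKaramataBound ν)
include hν

lemma lintegral_numVertices_lt_top (t : ℝ) : ∫⁻ ω, numVertices T t ω ∂P < ∞ := by
  have hm := hν.totalWeight_ne_top
  have hheavy := hν.upperTail_ne_top one_pos
  have hlight := hν.lowerWeight_ne_top 1
  exact (hG.lintegral_numVertices_le_upperTail_add t 1).trans_lt (by finiteness)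

lemma lintegral_numEdges_lt_top (t : ℝ) : ∫⁻ ω, numEdges T t ω ∂P < ∞ := by
  have hm := hν.totalWeight_ne_top
  exact (hG.lintegral_numEdges_le t).trans_lt (by finiteness)

lemma lintegral_numBinaryEdges_lt_top (t : ℝ) : ∫⁻ ω, numBinaryEdges T t ω ∂P < ∞ := by
  have hm := hν.totalWeight_ne_top
  have hheavy := hν.upperTail_ne_top one_pos
  have hlight := hν.lowerWeight_ne_top 1
  exact (hG.lintegral_numBinaryEdges_le_upperTail_sq_add t 1).trans_lt (by finiteness)

theorem isBigO_lintegral_numVertices :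
    (fun t => (∫⁻ ω, numVertices T t ω ∂P).toReal) =O[atTop]
      fun t => (upperTail ν t⁻¹).toReal := by
  obtain ⟨C, hC, hle⟩ := hν.exists_ofReal_mul_lowerWeight_inv_le
  have hm := hν.totalWeight_ne_top
  refine isBigO_toReal_of_eventually_le (K := 1 + C * totalWeight ν) (by finiteness) ?_ ?_
  · filter_upwards [eventually_gt_atTop 0] with t ht using hν.upperTail_ne_top (inv_pos.2 ht)
  filter_upwards [hle] with t ht
  calc ∫⁻ ω, numVertices T t ω ∂P
      ≤ upperTail ν t⁻¹ + ENNReal.ofReal t * (lowerWeight ν t⁻¹ * totalWeight ν) :=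
        hG.lintegral_numVertices_le_upperTail_add t t⁻¹
    _ = upperTail ν t⁻¹ + ENNReal.ofReal t * lowerWeight ν t⁻¹ * totalWeight ν := by ring
    _ ≤ upperTail ν t⁻¹ + C * upperTail ν t⁻¹ * totalWeight ν := by gcongr
    _ = (1 + C * totalWeight ν) * upperTail ν t⁻¹ := by ring

theorem isBigO_upperTail_lintegral_numVertices :
    (fun t : ℝ => (upperTail ν t⁻¹).toReal) =O[atTop]
      fun t => (∫⁻ ω, numVertices T t ω ∂P).toReal := by
  obtain ⟨a, ha, ha0⟩ := hν.exists_upperTail_ne_zero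
  have hpoisson := poissonMeasure_Ici_ne_zero
    (ENNReal.toNNReal_ne_zero.2 ⟨ha0, hν.upperTail_ne_top ha⟩) 2
  refine isBigO_toReal_of_eventually_mul_le
    (mul_ne_zero (a := ENNReal.ofReal (1 - Real.exp (-a))) (by simpa using ha) hpoisson)
    (.of_forall fun t => (hG.lintegral_numVertices_lt_top hν t).ne) ?_
  filter_upwards [eventually_ge_atTop a⁻¹] with t hat
  have ht : 0 < t := (inv_pos.2 ha).trans_le hat
  refine hG.le_lintegral_numVertices (measurableSet_setOf_le_coe a) (measurableSet_setOf_le_coe t⁻¹)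
    (hν.upperTail_ne_top (inv_pos.2 ht)) (fun v hv => (inv_le_of_inv_le₀ ha hat).trans hv) ?_
  intro u hu v hv
  calc a = t⁻¹ * a * t := by field_simp
    _ ≤ u * v * t.toNNReal := by
      rw [Real.coe_toNNReal t ht.le]
      gcongr
      exacts [u.2.1, hu, hv]

theorem isTheta_lintegral_numVertices :
    (fun t => (∫⁻ ω, numVertices T t ω ∂P).toReal) =Θ[atTop]
      fun t => (upperTail ν t⁻¹).toReal :=
  ⟨hG.isBigO_lintegral_numVertices hν, hG.isBigO_upperTail_lintegral_numVertices hν⟩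

theorem isTheta_lintegral_numEdges :
    (fun t => (∫⁻ ω, numEdges T t ω ∂P).toReal) =Θ[atTop] fun t : ℝ => t := by
  have hm := hν.totalWeight_ne_top
  obtain ⟨c, hc, hle⟩ := hG.exists_mul_le_lintegral_numEdges hν.totalWeight_ne_zero
  have hid : (fun t : ℝ => (ENNReal.ofReal t).toReal) =ᶠ[atTop] fun t => t :=
    (eventually_ge_atTop 0).mono fun t ht => ENNReal.toReal_ofReal ht
  refine IsTheta.trans_eventuallyEq ⟨?_, ?_⟩ hid
  · refine isBigO_toReal_of_eventually_le (K := 2⁻¹ * (totalWeight ν * totalWeight ν))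
      (by finiteness) (.of_forall fun t => ENNReal.ofReal_ne_top) (.of_forall fun t => ?_)
    exact (hG.lintegral_numEdges_le t).trans_eq (by ring)
  · exact isBigO_toReal_of_eventually_mul_le hc
      (.of_forall fun t => (hG.lintegral_numEdges_lt_top hν t).ne) (.of_forall hle)

theorem isBigO_lintegral_numBinaryEdges_mul_sqrt :
    (fun t => (∫⁻ ω, numBinaryEdges T t ω ∂P).toReal) =O[atTop]
      fun t => (upperTail ν (√t)⁻¹).toReal * √t := by
  obtain ⟨C, hC, hle⟩ := hν.exists_ofReal_mul_lowerWeight_inv_le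
  have hm := hν.totalWeight_ne_top
  have hpos : ∀ᶠ t : ℝ in atTop, 0 < √t :=
    (eventually_gt_atTop 0).mono fun t => Real.sqrt_pos.2
  have hbound := isBigO_toReal_of_eventually_le (F := atTop)
    (a := fun t => ∫⁻ ω, numBinaryEdges T t ω ∂P)
    (b := fun t => upperTail ν (√t)⁻¹ * ENNReal.ofReal √t)
    (K := totalWeight ν + 2 * (C * totalWeight ν)) (by finiteness) ?_ ?_
  · simpa only [ENNReal.toReal_mul, ENNReal.toReal_ofReal (Real.sqrt_nonneg _)] using hbound
  · filter_upwards [hpos] with t ht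
    exact ENNReal.mul_ne_top (hν.upperTail_ne_top (inv_pos.2 ht)) ENNReal.ofReal_ne_top
  filter_upwards [Real.tendsto_sqrt_atTop.eventually hle, hpos] with t hlight ht
  calc ∫⁻ ω, numBinaryEdges T t ω ∂P
      ≤ upperTail ν (√t)⁻¹ * upperTail ν (√t)⁻¹ +
          2 * (ENNReal.ofReal t * (lowerWeight ν (√t)⁻¹ * totalWeight ν)) :=
        hG.lintegral_numBinaryEdges_le_upperTail_sq_add t (√t)⁻¹
    _ = upperTail ν (√t)⁻¹ * upperTail ν (√t)⁻¹ + 2 * (ENNReal.ofReal √t *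
          (ENNReal.ofReal √t * lowerWeight ν (√t)⁻¹) * totalWeight ν) := by
        rw [ofReal_eq_ofReal_sqrt_mul_self (Real.sqrt_pos.1 ht).le]
        ring
    _ ≤ upperTail ν (√t)⁻¹ * (ENNReal.ofReal √t * totalWeight ν) + 2 * (ENNReal.ofReal √t *
          (C * upperTail ν (√t)⁻¹) * totalWeight ν) := by
        gcongr
        exact upperTail_inv_le ht
    _ = _ := by ring

theorem isBigO_lintegral_numBinaryEdges_mul_upperTail :
    (fun t => (∫⁻ ω, numBinaryEdges T t ω ∂P).toReal) =O[atTop]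
      fun t => (upperTail ν (√t)⁻¹).toReal * (upperTail ν t⁻¹).toReal := by
  obtain ⟨C, hC, hle⟩ := hν.exists_ofReal_mul_lowerWeight_inv_le
  simp_rw [← ENNReal.toReal_mul]
  refine isBigO_toReal_of_eventually_le (K := 2 * (1 + C) + C * C) (by finiteness) ?_ ?_
  · filter_upwards [eventually_gt_atTop 0] with t ht
    exact ENNReal.mul_ne_top (hν.upperTail_ne_top (inv_pos.2 (Real.sqrt_pos.2 ht)))
      (hν.upperTail_ne_top (inv_pos.2 ht))
  filter_upwards [hle, Real.tendsto_sqrt_atTop.eventually hle, eventually_ge_atTop 1]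
    with t hlight hlight_sqrt ht
  have hmono : upperTail ν (√t)⁻¹ ≤ upperTail ν t⁻¹ :=
    upperTail_antitone ν (inv_anti₀ (by positivity) (Real.sqrt_le_self_iff.2 (Or.inr ht)))
  calc ∫⁻ ω, numBinaryEdges T t ω ∂P
      ≤ 2 * (upperTail ν (√t)⁻¹ * (upperTail ν t⁻¹ + ENNReal.ofReal t * lowerWeight ν t⁻¹)) +
          ENNReal.ofReal t * (lowerWeight ν (√t)⁻¹ * lowerWeight ν (√t)⁻¹) :=
        hG.lintegral_numBinaryEdges_le_upperTail_mul_add t (√t)⁻¹ t⁻¹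
    _ = 2 * (upperTail ν (√t)⁻¹ * (upperTail ν t⁻¹ + ENNReal.ofReal t * lowerWeight ν t⁻¹)) +
          (ENNReal.ofReal √t * lowerWeight ν (√t)⁻¹) *
            (ENNReal.ofReal √t * lowerWeight ν (√t)⁻¹) := by
        rw [ofReal_eq_ofReal_sqrt_mul_self (zero_le_one.trans ht)]
        ring
    _ ≤ 2 * (upperTail ν (√t)⁻¹ * (upperTail ν t⁻¹ + C * upperTail ν t⁻¹)) +
          (C * upperTail ν (√t)⁻¹) * (C * upperTail ν t⁻¹) := by
        refine add_le_add (by gcongr) (mul_le_mul' hlight_sqrt (hlight_sqrt.trans ?_))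
        gcongr
    _ = (2 * (1 + C) + C * C) * (upperTail ν (√t)⁻¹ * upperTail ν t⁻¹) := by ring

end IsPoissonizedGraph

/-! ### Regular variation -/

section RegularVariation

variable {ν : Measure unitInterval}

lemma indicator_Iio_le_tsum {x y : ℝ} (hx : 0 < x) (hy : 0 ≤ y) :
    (Set.Iio x).indicator ENNReal.ofReal y ≤
      ∑' k : ℕ, ENNReal.ofReal (x / 2 ^ k) * (Set.Ici (x / 2 ^ (k + 1))).indicator 1 y := by
  by_cases hyx : y < x
  swap
  · simp [hyx]
  rcases hy.eq_or_lt with rfl | hy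
  · simp [Set.indicator_apply]
  obtain ⟨k, hk_lt, hk_le⟩ := exists_nat_pow_near_of_lt_one (div_pos hy hx)
    ((div_lt_one hx).2 hyx).le (y := (2⁻¹ : ℝ)) (by norm_num) (by norm_num)
  rw [inv_pow, lt_div_iff₀ hx, inv_mul_eq_div] at hk_lt
  rw [inv_pow, div_le_iff₀ hx, inv_mul_eq_div] at hk_le
  calc (Set.Iio x).indicator ENNReal.ofReal y
      ≤ ENNReal.ofReal (x / 2 ^ k) := by
        rw [Set.indicator_of_mem (Set.mem_Iio.2 hyx)]
        exact ENNReal.ofReal_le_ofReal hk_le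
    _ = ENNReal.ofReal (x / 2 ^ k) * (Set.Ici (x / 2 ^ (k + 1))).indicator 1 y := by
        rw [Set.indicator_of_mem (Set.mem_Ici.2 hk_lt.le), Pi.one_apply, mul_one]
    _ ≤ _ := ENNReal.le_tsum (f := fun k : ℕ => ENNReal.ofReal (x / 2 ^ k) *
        (Set.Ici (x / 2 ^ (k + 1))).indicator 1 y) k

lemma lowerWeight_le_tsum {x : ℝ} (hx : 0 < x) :
    lowerWeight ν x ≤
      ∑' k : ℕ, ENNReal.ofReal (x / 2 ^ k) * upperTail ν (x / 2 ^ (k + 1)) := by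
  have hm (y : ℝ) : Measurable fun v : unitInterval =>
      (Set.Ici y).indicator (1 : ℝ → ℝ≥0∞) v :=
    (measurable_one.indicator measurableSet_Ici).comp measurable_subtype_coe
  have htail (y : ℝ) : ∫⁻ v : unitInterval, (Set.Ici y).indicator 1 (v : ℝ) ∂ν = upperTail ν y :=
    lintegral_indicator_one (measurableSet_setOf_le_coe y)
  calc lowerWeight ν x
      = ∫⁻ v : unitInterval, (Set.Iio x).indicator ENNReal.ofReal (v : ℝ) ∂ν := by
        rw [lowerWeight, totalWeight, ← lintegral_indicator (measurableSet_setOf_le_coe x).compl]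
        refine lintegral_congr fun v => ?_
        simp [Set.indicator_apply]
    _ ≤ ∫⁻ v : unitInterval, ∑' k : ℕ,
          ENNReal.ofReal (x / 2 ^ k) * (Set.Ici (x / 2 ^ (k + 1))).indicator 1 (v : ℝ) ∂ν :=
        lintegral_mono fun v => indicator_Iio_le_tsum hx v.2.1
    _ = _ := by
        rw [lintegral_tsum fun k => ((hm _).const_mul _).aemeasurable]
        simp_rw [lintegral_const_mul _ (hm _), htail]

lemma upperTail_div_two_pow_le {c : ℝ≥0∞} {x : ℝ} (hx : 0 < x)
    (hhalf : ∀ y, 0 < y → y ≤ x → upperTail ν (y / 2) ≤ c * upperTail ν y) (k : ℕ) :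
    upperTail ν (x / 2 ^ k) ≤ c ^ k * upperTail ν x := by
  induction k with
  | zero => simp
  | succ k ih =>
    calc upperTail ν (x / 2 ^ (k + 1)) = upperTail ν (x / 2 ^ k / 2) := by rw [pow_succ, div_div]
      _ ≤ c * upperTail ν (x / 2 ^ k) :=
        hhalf _ (by positivity) (div_le_self hx.le (one_le_pow₀ one_le_two))
      _ ≤ c * (c ^ k * upperTail ν x) := by gcongr
      _ = c ^ (k + 1) * upperTail ν x := by ring

lemma lowerWeight_le_of_upperTail_half_le {c : ℝ≥0∞} {x : ℝ} (hx : 0 < x)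
    (hhalf : ∀ y, 0 < y → y ≤ x → upperTail ν (y / 2) ≤ c * upperTail ν y) :
    lowerWeight ν x ≤ c * (1 - 2⁻¹ * c)⁻¹ * (ENNReal.ofReal x * upperTail ν x) := by
  have hpow (k : ℕ) : ENNReal.ofReal (x / 2 ^ k) = ENNReal.ofReal x * 2⁻¹ ^ k := by
    rw [ENNReal.ofReal_div_of_pos (by positivity), ENNReal.ofReal_pow two_pos.le,
      ENNReal.ofReal_ofNat, div_eq_mul_inv, ENNReal.inv_pow]
  calc lowerWeight ν x
      ≤ ∑' k : ℕ, ENNReal.ofReal (x / 2 ^ k) * upperTail ν (x / 2 ^ (k + 1)) :=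
        lowerWeight_le_tsum hx
    _ ≤ ∑' k : ℕ, ENNReal.ofReal (x / 2 ^ k) * (c ^ (k + 1) * upperTail ν x) := by
        gcongr
        exact upperTail_div_two_pow_le hx hhalf _
    _ = ∑' k : ℕ, c * (ENNReal.ofReal x * upperTail ν x) * (2⁻¹ * c) ^ k := by
        simp_rw [hpow]
        exact tsum_congr fun k => by ring
    _ = _ := by
        rw [ENNReal.tsum_mul_left, ENNReal.tsum_geometric]
        ring

/-- Halving `x` costs at most a factor `c < 2` in the tail, so the truncated first moment is
dominated by a geometric series over dyadic scales. -/
theorem hasKaramataBound_of_tendsto_half {c : ℝ} (hc0 : c ≠ 0) (hc2 : c < 2)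
    (hc : Tendsto (fun x => (upperTail ν (x / 2)).toReal / (upperTail ν x).toReal)
      (𝓝[>] 0) (𝓝 c)) : HasKaramataBound ν := by
  have hne : ∀ᶠ x in 𝓝[>] 0, (upperTail ν (x / 2)).toReal ≠ 0 ∧ (upperTail ν x).toReal ≠ 0 :=
    (hc.eventually_ne hc0).mono fun x => div_ne_zero_iff.1
  obtain ⟨b, hcb, hb2⟩ := exists_between hc2
  have hhalf : ∀ᶠ x in 𝓝[>] 0, upperTail ν (x / 2) ≤ ENNReal.ofReal b * upperTail ν x := by
    filter_upwards [hne, hc.eventually_lt_const hcb] with x ⟨hx_half, hx⟩ hlt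
    rw [div_lt_iff₀ (ENNReal.toReal_nonneg.lt_of_ne' hx)] at hlt
    rw [← ENNReal.ofReal_toReal (ENNReal.toReal_ne_zero.1 hx_half).2,
      ← ENNReal.ofReal_toReal (ENNReal.toReal_ne_zero.1 hx).2,
      ← ENNReal.ofReal_mul' ENNReal.toReal_nonneg]
    exact ENNReal.ofReal_le_ofReal hlt.le
  have hratio : 2⁻¹ * ENNReal.ofReal b < 1 := by
    rw [mul_comm, ← div_eq_mul_inv]
    exact ENNReal.div_lt_of_lt_mul (by simpa using hb2)
  obtain ⟨δ, hδ, hsub⟩ := mem_nhdsGT_iff_exists_Ioo_subset.1 hhalf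
  exact
    { eventually_upperTail_ne_zero := hne.mono fun x hx => (ENNReal.toReal_ne_zero.1 hx.2).1
      eventually_upperTail_ne_top := hne.mono fun x hx => (ENNReal.toReal_ne_zero.1 hx.2).2
      exists_lowerWeight_le := by
        refine ⟨ENNReal.ofReal b * (1 - 2⁻¹ * ENNReal.ofReal b)⁻¹, ENNReal.mul_ne_top
          ENNReal.ofReal_ne_top (ENNReal.inv_ne_top.2 (tsub_pos_of_lt hratio).ne'), ?_⟩
        filter_upwards [Ioo_mem_nhdsGT hδ] with x hx
        exact lowerWeight_le_of_upperTail_half_le hx.1 fun y hy hyx =>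
          hsub ⟨hy, hyx.trans_lt hx.2⟩ }

variable {α : ℝ} {l : ℝ → ℝ}

theorem tendsto_upperTail_half_div (hl : IsSlowlyVarying l)
    (htail : (fun x => (upperTail ν x).toReal) ~[𝓝[>] 0] fun x => x ^ (-α) * l x⁻¹) :
    Tendsto (fun x => (upperTail ν (x / 2)).toReal / (upperTail ν x).toReal)
      (𝓝[>] 0) (𝓝 (2 ^ α)) := by
  have hhalf : Tendsto (fun x : ℝ => x / 2) (𝓝[>] 0) (𝓝[>] 0) := by
    refine tendsto_nhdsWithin_iff.2
      ⟨?_, eventually_mem_nhdsWithin.mono fun x hx => half_pos (Set.mem_Ioi.1 hx)⟩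
    simpa using ((continuous_id.div_const (2 : ℝ)).tendsto 0).mono_left nhdsWithin_le_nhds
  refine ((htail.comp_tendsto hhalf).div htail).tendsto_nhds_iff.2 ?_
  have hlim := ((hl.2 2 two_pos).comp tendsto_inv_nhdsGT_zero).const_mul ((2 : ℝ) ^ α)
  rw [mul_one] at hlim
  refine hlim.congr' ?_
  filter_upwards [self_mem_nhdsWithin] with x hx
  have hx : 0 < x := hx
  have hpow : x ^ (-α) ≠ 0 := (Real.rpow_pos_of_pos hx _).ne'
  simp only [Function.comp_apply, Pi.div_apply]
  rw [Real.div_rpow hx.le two_pos.le, Real.rpow_neg two_pos.le, inv_div, div_eq_mul_inv 2 x]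
  field_simp

theorem hasKaramataBound_of_isEquivalent (hα : α < 1) (hl : IsSlowlyVarying l)
    (htail : (fun x => (upperTail ν x).toReal) ~[𝓝[>] 0] fun x => x ^ (-α) * l x⁻¹) :
    HasKaramataBound ν := by
  have hα2 : (2 : ℝ) ^ α < 2 := by
    simpa using Real.rpow_lt_rpow_of_exponent_lt one_lt_two hα
  exact hasKaramataBound_of_tendsto_half (by positivity) hα2 (tendsto_upperTail_half_div hl htail)

lemma isEquivalent_upperTail_inv
    (htail : (fun x => (upperTail ν x).toReal) ~[𝓝[>] 0] fun x => x ^ (-α) * l x⁻¹) :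
    (fun t => (upperTail ν t⁻¹).toReal) ~[atTop] fun t => t ^ α * l t := by
  refine (htail.comp_tendsto tendsto_inv_atTop_nhdsGT_zero).congr_right ?_
  filter_upwards [eventually_gt_atTop 0] with t ht
  simp [Real.inv_rpow ht.le, Real.rpow_neg ht.le]

end RegularVariation

lemma isBigO_mul_min {ι : Type*} {F : Filter ι} {f g a b : ι → ℝ}
    (ha : f =O[F] fun t => g t * a t) (hb : f =O[F] fun t => g t * b t) :
    f =O[F] fun t => g t * min (a t) (b t) := by
  obtain ⟨A, hA⟩ := ha.bound
  obtain ⟨B, hB⟩ := hb.bound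
  refine IsBigO.of_bound (max A B) ?_
  filter_upwards [hA, hB] with t hAt hBt
  rcases min_choice (a t) (b t) with h | h <;> rw [h]
  · exact hAt.trans (by gcongr; exact le_max_left A B)
  · exact hBt.trans (by gcongr; exact le_max_right A B)

theorem lemma5_general {Ω : Type*} [MeasurableSpace Ω] {P : Measure Ω} {ν : Measure unitInterval}
    [SigmaFinite ν] {w : ℕ → Ω → unitInterval} {T : ℕ → ℕ → Ω → Set ℝ}
    (hG : IsPoissonizedGraph ν P w T) {α : ℝ} {l : ℝ → ℝ} (hα : α < 1) (hl : IsSlowlyVarying l)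
    (htail : (fun x : ℝ => ν.real {v : unitInterval | x ≤ (v : ℝ)}) ~[𝓝[>] 0]
      fun x : ℝ => x ^ (-α) * l x⁻¹) :
    (∀ t : ℝ, ∫⁻ ω, numVertices T t ω ∂P < ∞ ∧ ∫⁻ ω, numEdges T t ω ∂P < ∞ ∧
      ∫⁻ ω, numBinaryEdges T t ω ∂P < ∞) ∧
    (fun t : ℝ => (∫⁻ ω, numVertices T t ω ∂P).toReal) =Θ[atTop] (fun t : ℝ => t ^ α * l t) ∧
    (fun t : ℝ => (∫⁻ ω, numEdges T t ω ∂P).toReal) =Θ[atTop] (fun t : ℝ => t) ∧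
    (fun t : ℝ => (∫⁻ ω, numBinaryEdges T t ω ∂P).toReal) =O[atTop]
      (fun t : ℝ => l √t * min (t ^ ((1 + α) / 2)) (l t * t ^ (3 * α / 2))) := by
  have hν : HasKaramataBound ν := hasKaramataBound_of_isEquivalent hα hl htail
  have hH := isEquivalent_upperTail_inv htail
  have hHsqrt := (hH.comp_tendsto Real.tendsto_sqrt_atTop).isBigO
  have hpow (t : ℝ) (ht : 0 < t) : √t ^ α = t ^ (α / 2) := by
    rw [Real.sqrt_eq_rpow, ← Real.rpow_mul ht.le, one_div_mul_eq_div]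
  refine ⟨fun t => ⟨hG.lintegral_numVertices_lt_top hν t, hG.lintegral_numEdges_lt_top hν t,
    hG.lintegral_numBinaryEdges_lt_top hν t⟩,
    (hG.isTheta_lintegral_numVertices hν).trans hH.isTheta, hG.isTheta_lintegral_numEdges hν,
    isBigO_mul_min ?_ ?_⟩
  · refine ((hG.isBigO_lintegral_numBinaryEdges_mul_sqrt hν).trans
      (hHsqrt.mul (isBigO_refl _ _))).congr' .rfl ?_
    filter_upwards [eventually_gt_atTop 0] with t ht
    simp only [Function.comp_apply]
    rw [hpow t ht, mul_right_comm, mul_comm, Real.sqrt_eq_rpow t, ← Real.rpow_add ht]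
    ring_nf
  · refine ((hG.isBigO_lintegral_numBinaryEdges_mul_upperTail hν).trans
      (hHsqrt.mul hH.isBigO)).congr' .rfl ?_
    filter_upwards [eventually_gt_atTop 0] with t ht
    simp only [Function.comp_apply]
    rw [hpow t ht, show 3 * α / 2 = α / 2 + α by ring, Real.rpow_add ht]
    ring

theorem lemma5 {Ω : Type*} [MeasurableSpace Ω] (P : Measure Ω) [IsProbabilityMeasure P]
    (ν : Measure unitInterval) [SigmaFinite ν] [NullSingletonClass ν]
    (hν_infinite : ν Set.univ = ∞)
    (hν_mean : ∫⁻ v, ENNReal.ofReal (v : ℝ) ∂ν < ∞)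
    (w : ℕ → Ω → unitInterval) (T : ℕ → ℕ → Ω → Set ℝ)
    (hG : IsPoissonizedGraph ν P w T)
    (α : ℝ) (l : ℝ → ℝ) (htail : HasRegularlyVaryingTail ν α l) :
    (∀ n : ℕ, ∫⁻ ω, numVertices T n ω ∂P < ∞ ∧ ∫⁻ ω, numEdges T n ω ∂P < ∞ ∧
      ∫⁻ ω, numBinaryEdges T n ω ∂P < ∞) ∧
    (fun n : ℕ => (∫⁻ ω, numVertices T n ω ∂P).toReal) =Θ[atTop]
      (fun n : ℕ => (n : ℝ) ^ α * l n) ∧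
    (fun n : ℕ => (∫⁻ ω, numEdges T n ω ∂P).toReal) =Θ[atTop] (fun n : ℕ => (n : ℝ)) ∧
    (fun n : ℕ => (∫⁻ ω, numBinaryEdges T n ω ∂P).toReal) =O[atTop]
      (fun n : ℕ => l (√(n : ℝ)) *
        min ((n : ℝ) ^ ((1 + α) / 2)) (l n * (n : ℝ) ^ (3 * α / 2))) := by
  obtain ⟨hfin, hV, hE, hB⟩ := lemma5_general hG htail.2.1 htail.2.2.1 htail.2.2.2
  exact ⟨fun n => hfin n, hV.imp .natCast_atTop .natCast_atTop,
    hE.imp .natCast_atTop .natCast_atTop, hB.natCast_atTop⟩
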